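/- Let $G$ be a Lie group with Lie algebra $\mathfrak g$, let $K\subset H$ be compact subgroups of $G$ with Lie algebras $\mathfrak k\subset\mathfrak h$, and let $\pi:G/K\to G/H$, $aK\mapsto aH$, be the natural projection. Let $\mathfrak m$ be an $\mathrm{Ad}(H)$-invariant complement of $\mathfrak h$ in $\mathfrak g$ with an $\mathrm{Ad}(H)$-invariant scalar product $\langle\cdot,\cdot\rangle_{\mathfrak m}$, and let $\mathfrak p$ be an $\mathrm{Ad}(K)$-invariant complement of $\mathfrak k$ in $\mathfrak h$ with an $\mathrm{Ad}(K)$-invariant scalar product $\langle\cdot,\cdot\rangle_{\mathfrak p}$. Let $g$ be the $G$-invariant Riemannian metric on $G/H$ induced by $\langle\cdot,\cdot\rangle_{\mathfrak m}$, and let $\hat g$ be the $G$-invariant Riemannian metric on $G/K$ induced by the orthogonal sum $\langle\cdot,\cdot\rangle_{\mathfrak m}+\langle\cdot,\cdot\rangle_{\mathfrak p}$ on $\mathfrak m\oplus\mathfrak p$ (then $\pi:(G/K,\hat g)\to(G/H,g)$ is called a homogeneous Riemannian fibration). A continuous map $\psi:(M,g_M)\to(N,h)$ between Riemannian manifolds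 is called a harmonic morphism if, for every harmonic function $f:U\to\mathbb R$ defined on an open subset $U$ of $N$ with $\psi^{-1}(U)$ non-empty, the composition $f\circ\psi:\psi^{-1}(U)\to\mathbb R$ is a harmonic function. Here a real-valued function on an open subset of a Riemannian manifold is harmonic if it is twice continuously differentiable and its Laplacian vanishes. Let $(N,h)$ be a Riemannian manifold and $\phi:G/H\to N$ a map. Then $\phi:(G/H,g)\to(N,h)$ is a harmonic morphism if and only if $\phi\circ\pi:(G/K,\hat g)\to(N,h)$ is a harmonic morphism. -/

import Mathlib

open Bundle Set Topology Manifold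
open scoped ContDiff

noncomputable section

namespace HarmonicMorphism

/-! ### Riemannian metrics, the Laplacian, harmonic functions, harmonic morphisms -/

/-- Smooth Riemannian metrics on an `n`-dimensional smooth manifold `M`. -/
abbrev RiemMetric (n : ℕ) (M : Type*) [TopologicalSpace M]
    [ChartedSpace (EuclideanSpace ℝ (Fin n)) M] [IsManifold (𝓡 n) ∞ M] :=
  ContMDiffRiemannianMetric (𝓡 n) ∞ (EuclideanSpace ℝ (Fin n))
    (fun x : M ↦ TangentSpace (𝓡 n) x)

section Laplacian

variable {n : ℕ} {M : Type*} [TopologicalSpace M]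
  [ChartedSpace (EuclideanSpace ℝ (Fin n)) M] [IsManifold (𝓡 n) ∞ M]

/-- The standard basis vector `e i` of `ℝⁿ`. -/
def stdVec (i : Fin n) : EuclideanSpace ℝ (Fin n) := EuclideanSpace.single i 1

/-- The matrix `(g_ij)` of the metric in the chart at `x`, as a function of the coordinate
`y ∈ ℝⁿ`: here `g_ij(y) = g(∂_i, ∂_j)`, where `∂_i` is the image of `e i` under the derivative at
`y` of the inverse of the chart. -/
def gram (g : RiemMetric n M) (x : M) (y : EuclideanSpace ℝ (Fin n)) : Matrix (Fin n) (Fin n) ℝ :=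
  Matrix.of fun i j ↦
    g.inner ((extChartAt (𝓡 n) x).symm y)
      (mfderiv 𝓘(ℝ, EuclideanSpace ℝ (Fin n)) (𝓡 n) (extChartAt (𝓡 n) x).symm y (stdVec i))
      (mfderiv 𝓘(ℝ, EuclideanSpace ℝ (Fin n)) (𝓡 n) (extChartAt (𝓡 n) x).symm y (stdVec j))

/-- The partial derivative `∂_i u` of a real function on `ℝⁿ`. -/
def pderiv (i : Fin n) (u : EuclideanSpace ℝ (Fin n) → ℝ) (y : EuclideanSpace ℝ (Fin n)) : ℝ :=
  fderiv ℝ u y (stdVec i)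

/-- The Christoffel symbol of the Levi-Civita connection in the chart at `x`,
`Γ^k_ij = ½ ∑_l g^kl (∂_i g_jl + ∂_j g_il - ∂_l g_ij)`. -/
def christoffel (g : RiemMetric n M) (x : M) (k i j : Fin n) (y : EuclideanSpace ℝ (Fin n)) : ℝ :=
  (1 / 2 : ℝ) * ∑ l, (gram g x y)⁻¹ k l *
    (pderiv i (fun z ↦ gram g x z j l) y + pderiv j (fun z ↦ gram g x z i l) y
      - pderiv l (fun z ↦ gram g x z i j) y)

/-- The Laplacian `Δ f = trace_g ∇df` of a function `f` at `x`, computed in the chart at `x`: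
`Δ f = ∑_ij g^ij (∂_i ∂_j f - ∑_k Γ^k_ij ∂_k f)`. -/
def laplacian (g : RiemMetric n M) (f : M → ℝ) (x : M) : ℝ :=
  let y := extChartAt (𝓡 n) x x
  let u := f ∘ (extChartAt (𝓡 n) x).symm
  ∑ i, ∑ j, (gram g x y)⁻¹ i j *
    (pderiv i (pderiv j u) y - ∑ k, christoffel g x k i j y * pderiv k u y)

/-- `f` is harmonic on `U`: the set `U` is open, `f` is twice continuously differentiable on `U`,
and its Laplacian vanishes there. The values of `f` off `U` play no role. -/
structure IsHarmonicOn (g : RiemMetric n M) (f : M → ℝ) (U : Set M) : Prop where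
  isOpen : IsOpen U
  contMDiffOn : ContMDiffOn (𝓡 n) 𝓘(ℝ, ℝ) 2 f U
  laplacian_eq_zero : ∀ x ∈ U, laplacian g f x = 0

/-- A harmonic morphism: a continuous map that pulls back local harmonic functions to harmonic
functions. -/
structure IsHarmonicMorphism {m : ℕ} {N : Type*} [TopologicalSpace N]
    [ChartedSpace (EuclideanSpace ℝ (Fin m)) N] [IsManifold (𝓡 m) ∞ N]
    (g : RiemMetric n M) (h : RiemMetric m N) (φ : M → N) : Prop where
  continuous : Continuous φ
  comp : ∀ (U : Set N) (f : N → ℝ), IsHarmonicOn h f U → (φ ⁻¹' U).Nonempty →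
    IsHarmonicOn g (f ∘ φ) (φ ⁻¹' U)

end Laplacian

/-! ### Lie groups and homogeneous spaces -/

section Homogeneous

variable {d : ℕ} {G : Type*} [TopologicalSpace G] [ChartedSpace (EuclideanSpace ℝ (Fin d)) G]
  [Group G] [LieGroup (𝓡 d) ∞ G]

/-- `γ` is a curve in `L`, smooth at time `0`, starting at the identity with velocity `X`. -/
structure IsCurveIn (L : Subgroup G) (X : GroupLieAlgebra (𝓡 d) G) (γ : ℝ → G) : Prop where
  zero : γ 0 = 1
  mem : ∀ t, γ t ∈ L
  smooth : ContMDiffAt 𝓘(ℝ, ℝ) (𝓡 d) ∞ γ 0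
  velocity : (mfderiv 𝓘(ℝ, ℝ) (𝓡 d) γ 0 : ℝ →L[ℝ] EuclideanSpace ℝ (Fin d)) 1 = X

/-- The Lie algebra of a closed subgroup `L` of `G`, as a subspace of the Lie algebra of `G`: the
space of the velocities at the identity of curves in `L`. -/
def lieAlgebraOf (L : Subgroup G) : Submodule ℝ (GroupLieAlgebra (𝓡 d) G) where
  carrier := {X | ∃ γ : ℝ → G, IsCurveIn L X γ}
  zero_mem' := ⟨fun _ ↦ 1, rfl, fun _ ↦ L.one_mem, contMDiffAt_const, by
    rw [mfderiv_const]; rfl⟩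
  add_mem' := by
    rintro X Y ⟨γ, hγ⟩ ⟨δ, hδ⟩
    have hF : ContMDiffAt (𝓘(ℝ, ℝ).prod 𝓘(ℝ, ℝ)) (𝓡 d) ∞
        (fun z : ℝ × ℝ ↦ γ z.1 * δ z.2) ((0 : ℝ), (0 : ℝ)) :=
      ContMDiffAt.mul
        (ContMDiffAt.comp (x := ((0 : ℝ), (0 : ℝ))) (g := γ) (f := Prod.fst) hγ.smooth
          contMDiffAt_fst)
        (ContMDiffAt.comp (x := ((0 : ℝ), (0 : ℝ))) (g := δ) (f := Prod.snd) hδ.smooth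
          contMDiffAt_snd)
    have hF' := hF.mdifferentiableAt (by simp)
    refine ⟨fun t ↦ γ t * δ t, by simp [hγ.zero, hδ.zero], fun t ↦ L.mul_mem (hγ.mem t) (hδ.mem t),
      hγ.smooth.mul hδ.smooth, ?_⟩
    have hd : HasMFDerivAt 𝓘(ℝ, ℝ) (𝓘(ℝ, ℝ).prod 𝓘(ℝ, ℝ)) (fun t : ℝ ↦ (t, t)) 0
        ((ContinuousLinearMap.id ℝ ℝ).prod (ContinuousLinearMap.id ℝ ℝ)) :=
      (hasMFDerivAt_id (I := 𝓘(ℝ, ℝ)) (0 : ℝ)).prodMk (hasMFDerivAt_id (I := 𝓘(ℝ, ℝ)) (0 : ℝ))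
    have h1 := (HasMFDerivAt.comp (0 : ℝ) (f := fun t : ℝ ↦ (t, t))
      (g := fun z : ℝ × ℝ ↦ γ z.1 * δ z.2) hF'.hasMFDerivAt hd).mfderiv
    have h2 := mfderiv_prod_eq_add_apply (v := ((1 : ℝ), (1 : ℝ))) hF'
    have e1 : (fun z : ℝ ↦ γ z * δ 0) = γ := by simp [hδ.zero]
    have e2 : (fun z : ℝ ↦ γ 0 * δ z) = δ := by simp [hγ.zero]
    have h3 := hγ.velocity
    have h4 := hδ.velocity
    refine Eq.trans (congrArg (fun A : ℝ →L[ℝ] EuclideanSpace ℝ (Fin d) ↦ A 1) h1) ?_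
    refine Eq.trans h2 ?_
    refine congrArg₂ (fun u v : EuclideanSpace ℝ (Fin d) ↦ u + v) ?_ ?_
    · refine Eq.trans ?_ h3
      exact congrArg (fun c : ℝ → G ↦
        (mfderiv 𝓘(ℝ, ℝ) (𝓡 d) c 0 : ℝ →L[ℝ] EuclideanSpace ℝ (Fin d)) 1) e1
    · refine Eq.trans ?_ h4
      exact congrArg (fun c : ℝ → G ↦
        (mfderiv 𝓘(ℝ, ℝ) (𝓡 d) c 0 : ℝ →L[ℝ] EuclideanSpace ℝ (Fin d)) 1) e2
  smul_mem' := by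
    rintro c X ⟨γ, hγ⟩
    have hs : HasMFDerivAt 𝓘(ℝ, ℝ) 𝓘(ℝ, ℝ) (fun t : ℝ ↦ c * t) 0
        (c • ContinuousLinearMap.id ℝ ℝ) :=
      ((hasFDerivAt_id (𝕜 := ℝ) (0 : ℝ)).const_mul c).hasMFDerivAt
    have h0 : γ (c * 0) = 1 := by rw [mul_zero, hγ.zero]
    have hγ' : ContMDiffAt 𝓘(ℝ, ℝ) (𝓡 d) ∞ γ (c * 0) := by rw [mul_zero]; exact hγ.smooth
    have hc : ContMDiffAt 𝓘(ℝ, ℝ) 𝓘(ℝ, ℝ) ∞ (fun t : ℝ ↦ c * t) 0 :=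
      (contDiff_const.mul contDiff_id).contMDiff.contMDiffAt
    refine ⟨fun t ↦ γ (c * t), h0, fun t ↦ hγ.mem _,
      ContMDiffAt.comp (0 : ℝ) (g := γ) (f := fun t : ℝ ↦ c * t) hγ' hc, ?_⟩
    have h1 := (HasMFDerivAt.comp (0 : ℝ) (f := fun t : ℝ ↦ c * t) (g := γ)
      (hγ'.mdifferentiableAt (by simp)).hasMFDerivAt hs).mfderiv
    refine Eq.trans (congrArg (fun A : ℝ →L[ℝ] EuclideanSpace ℝ (Fin d) ↦ A 1) h1) ?_
    have h2 : (mfderiv 𝓘(ℝ, ℝ) (𝓡 d) γ (c * 0) : ℝ →L[ℝ] EuclideanSpace ℝ (Fin d)) 1 = X := by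
      rw [mul_zero]; exact hγ.velocity
    rw [← h2]
    exact (mfderiv 𝓘(ℝ, ℝ) (𝓡 d) γ (c * 0) : ℝ →L[ℝ] EuclideanSpace ℝ (Fin d)).map_smul c 1

/-- The adjoint representation: `Ad a` is the derivative at `1` of `x ↦ a x a⁻¹`. -/
def Ad (a : G) : GroupLieAlgebra (𝓡 d) G →L[ℝ] GroupLieAlgebra (𝓡 d) G :=
  (mfderiv (𝓡 d) (𝓡 d) (fun x : G ↦ a * x * a⁻¹) 1 :
    EuclideanSpace ℝ (Fin d) →L[ℝ] EuclideanSpace ℝ (Fin d))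

/-- The subspace `V` of the Lie algebra is `Ad(L)`-invariant. -/
def IsAdInvariant (L : Subgroup G) (V : Submodule ℝ (GroupLieAlgebra (𝓡 d) G)) : Prop :=
  ∀ a ∈ L, ∀ X ∈ V, Ad a X ∈ V

/-- `B` is an `Ad(L)`-invariant scalar product on the subspace `V` of the Lie algebra. -/
structure IsAdInvariantScalarProduct (L : Subgroup G)
    (V : Submodule ℝ (GroupLieAlgebra (𝓡 d) G)) (B : V →ₗ[ℝ] V →ₗ[ℝ] ℝ) : Prop where
  symm : ∀ X Y, B X Y = B Y X
  pos : ∀ X, X ≠ 0 → 0 < B X X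
  isAdInvariant : IsAdInvariant L V
  inv : ∀ (a : G) (ha : a ∈ L) (X Y : V),
    B ⟨Ad a X, isAdInvariant a ha X X.2⟩ ⟨Ad a Y, isAdInvariant a ha Y Y.2⟩ = B X Y

/-- The manifold structure on `G ⧸ L` is the quotient one, that is, the (unique) one for which the
projection `G → G ⧸ L` is a smooth submersion. -/
def IsQuotientManifold {e : ℕ} (L : Subgroup G)
    [ChartedSpace (EuclideanSpace ℝ (Fin e)) (G ⧸ L)] : Prop :=
  IsSubmersion (𝓡 d) (𝓡 e) ∞ (fun a : G ↦ (a : G ⧸ L))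

section Metric

variable {e : ℕ} {L : Subgroup G} [ChartedSpace (EuclideanSpace ℝ (Fin e)) (G ⧸ L)]
  [IsManifold (𝓡 e) ∞ (G ⧸ L)]

/-- The derivative at the identity of the projection `G → G ⧸ L`. -/
def dproj (L : Subgroup G) [ChartedSpace (EuclideanSpace ℝ (Fin e)) (G ⧸ L)]
    (X : GroupLieAlgebra (𝓡 d) G) : TangentSpace (𝓡 e) ((1 : G) : G ⧸ L) :=
  mfderiv (𝓡 d) (𝓡 e) (fun a : G ↦ (a : G ⧸ L)) 1 X

/-- The metric on `G ⧸ L` is `G`-invariant: left translations by elements of `G` are isometries. -/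
def IsInvariantMetric (g : RiemMetric e (G ⧸ L)) : Prop :=
  ∀ (a : G) (x : G ⧸ L) (u v : TangentSpace (𝓡 e) x),
    g.inner (a • x) (mfderiv (𝓡 e) (𝓡 e) (fun y : G ⧸ L ↦ a • y) x u)
      (mfderiv (𝓡 e) (𝓡 e) (fun y : G ⧸ L ↦ a • y) x v) = g.inner x u v

end Metric

/-- The data defining a homogeneous Riemannian fibration `G ⧸ K → G ⧸ H`, where `K ≤ H` are
compact subgroups of `G`:
* `m` is an `Ad(H)`-invariant complement of the Lie algebra of `H` in the Lie algebra of `G`, with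
  an `Ad(H)`-invariant scalar product `Bm`, which induces the `G`-invariant metric `g` on `G ⧸ H`;
* `p` is an `Ad(K)`-invariant complement of the Lie algebra of `K` in the Lie algebra of `H`, with
  an `Ad(K)`-invariant scalar product `Bp`;
* the orthogonal sum of `Bm` and `Bp` induces the `G`-invariant metric `g'` on `G ⧸ K`. -/
structure IsHomogeneousRiemannianFibration {dK dH : ℕ} (K H : Subgroup G)
    [ChartedSpace (EuclideanSpace ℝ (Fin dK)) (G ⧸ K)] [IsManifold (𝓡 dK) ∞ (G ⧸ K)]
    [ChartedSpace (EuclideanSpace ℝ (Fin dH)) (G ⧸ H)] [IsManifold (𝓡 dH) ∞ (G ⧸ H)]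
    (m p : Submodule ℝ (GroupLieAlgebra (𝓡 d) G))
    (Bm : m →ₗ[ℝ] m →ₗ[ℝ] ℝ) (Bp : p →ₗ[ℝ] p →ₗ[ℝ] ℝ)
    (g' : RiemMetric dK (G ⧸ K)) (g : RiemMetric dH (G ⧸ H)) : Prop where
  le : K ≤ H
  isCompact_K : IsCompact (K : Set G)
  isCompact_H : IsCompact (H : Set G)
  isQuotient_K : IsQuotientManifold (d := d) (e := dK) K
  isQuotient_H : IsQuotientManifold (d := d) (e := dH) H
  isCompl_m : IsCompl (lieAlgebraOf H) m
  inf_p : lieAlgebraOf K ⊓ p = ⊥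
  sup_p : lieAlgebraOf K ⊔ p = lieAlgebraOf H
  scalarProduct_m : IsAdInvariantScalarProduct H m Bm
  scalarProduct_p : IsAdInvariantScalarProduct K p Bp
  invariant_base : IsInvariantMetric g
  induced_base : ∀ X Y : m, g.inner _ (dproj (d := d) H X) (dproj (d := d) H Y) = Bm X Y
  invariant_total : IsInvariantMetric g'
  induced_total : ∀ (X Y : m) (P Q : p),
    g'.inner _ (dproj (d := d) K (X + P)) (dproj (d := d) K (Y + Q)) = Bm X Y + Bp P Q

end Homogeneous

end HarmonicMorphism

end

/-!
For a function `f` on `G ⧸ H` of class `C²`, the Laplacian of `f ∘ π` is the Laplacian of `f`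
composed with `π` (`IsHomogeneousRiemannianFibration.laplacian_comp`): `π` is a Riemannian submersion
with totally geodesic fibres. Since `π` is a surjective submersion, it detects continuity and
`C²`-regularity, so that harmonicity of `f ∘ φ` and of `f ∘ φ ∘ π` are equivalent.

The Laplacians are compared through Killing fields. If flows by isometries have velocity fields `ξ_a`
which at the point `x` satisfy Parseval's identity `g(u, v) = ∑ g(u, ξ_a) g(v, ξ_a)`, then at `x`
`Δ f = ∑_a ξ_a ξ_a f + ½ ∑_{a, b} (ξ_b |ξ_a|²) (ξ_b f)` (`laplacian_eq_sum_flows`), a consequence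
of Killing's equation at `x` (`killing_equation`) and the coordinate formula for the Laplacian. This
applies to the left action of `G` on `G ⧸ K` and on `G ⧸ H` with one and the same family of curves
in `G`, whose velocities at the identity run through orthonormal bases of `m` and of `p`
(`laplacian_eq_sum_Ad`); vectors in `p` generate the zero vector at the base point of `G ⧸ H`. The
terms `ξ_a ξ_a f` and `ξ_b f` then agree upstairs and downstairs, and `ξ_b f` vanishes for `b` in `p`.
For `b` in `m`, the squared lengths `|ξ_a|²` upstairs and downstairs differ by the squared length of
the `p`-component of `Ad (γ_b t)⁻¹ X_a`, whose derivative at `t = 0` is zero. This is clear for `X_a`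
in `m`, where the `p`-component vanishes at `t = 0`. For `X_a` in `p`, the derivative of
`Ad (γ_b t)⁻¹ X_a` equals that of `Ad (γ_a s) X_b` (`exists_hasDerivAt_Ad`), which lies in `m` because
`m` is `Ad(H)`-invariant.

Neither the exponential map nor one-parameter groups occur: each flow enters the formula through its
first-order behaviour at time `0` only, so any curve with the right velocity serves.
-/

open Bundle Set Topology Manifold
open scoped ContDiff

noncomputable section

namespace HarmonicMorphism

/-! ### Parseval families for a bilinear form and contraction with the inverse Gram matrix -/

section Parseval

variable {ι : Type*} [Fintype ι] {n : ℕ}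
  {B : EuclideanSpace ℝ (Fin n) →L[ℝ] EuclideanSpace ℝ (Fin n) →L[ℝ] ℝ}
  {ξ : ι → EuclideanSpace ℝ (Fin n)}

theorem sum_apply_stdVec {V : Type*} [AddCommGroup V] [Module ℝ V]
    (L : EuclideanSpace ℝ (Fin n) →ₗ[ℝ] V) (v : EuclideanSpace ℝ (Fin n)) :
    ∑ i, v i • L (stdVec i) = L v := by
  conv_rhs => rw [← (EuclideanSpace.basisFun (Fin n) ℝ).sum_repr v]
  simp [stdVec, map_sum]

/-- A family satisfying Parseval's identity for a definite form reproduces every vector. -/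
theorem sum_parseval_smul (hpos : ∀ v, v ≠ 0 → 0 < B v v)
    (hB : ∀ u w, B u w = ∑ a, B u (ξ a) * B w (ξ a)) (v : EuclideanSpace ℝ (Fin n)) :
    ∑ a, B v (ξ a) • ξ a = v := by
  by_contra hne
  have hsub : v - ∑ a, B v (ξ a) • ξ a ≠ 0 := fun h ↦ hne (sub_eq_zero.mp h).symm
  have hsymm : ∀ u w, B u w = B w u := fun u w ↦ by
    rw [hB u w, hB w u]
    exact Finset.sum_congr rfl fun a _ ↦ mul_comm _ _
  have h0 : ∀ w, B w (v - ∑ a, B v (ξ a) • ξ a) = 0 := fun w ↦ by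
    rw [map_sub, map_sum, hB w v, sub_eq_zero]
    refine Finset.sum_congr rfl fun a _ ↦ ?_
    rw [map_smul, smul_eq_mul, mul_comm]
  exact absurd (hpos _ hsub) (by rw [h0]; exact lt_irrefl 0)

/-- The inverse of the Gram matrix of `B` in the standard basis is `∑ ξ_a ξ_aᵀ` for every family
`ξ` satisfying Parseval's identity. -/
theorem inv_gram_eq_sum (hpos : ∀ v, v ≠ 0 → 0 < B v v)
    (hB : ∀ u w, B u w = ∑ a, B u (ξ a) * B w (ξ a)) :
    (Matrix.of fun i j : Fin n ↦ B (stdVec i) (stdVec j))⁻¹ =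
      Matrix.of fun i j ↦ ∑ a, ξ a i * ξ a j := by
  have hsymm : ∀ u w, B u w = B w u := fun u w ↦ by
    rw [hB u w, hB w u]
    exact Finset.sum_congr rfl fun a _ ↦ mul_comm _ _
  apply Matrix.inv_eq_left_inv
  ext i j
  rw [Matrix.mul_apply]
  have h1 : ∀ a, ∑ k, ξ a k * B (stdVec k) (stdVec j) = B (stdVec j) (ξ a) := fun a ↦ by
    refine Eq.trans (Finset.sum_congr rfl fun k _ ↦ ?_)
      (sum_apply_stdVec (B (stdVec j)).toLinearMap (ξ a))
    rw [hsymm]; rfl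
  calc ∑ k, (∑ a, ξ a i * ξ a k) * B (stdVec k) (stdVec j)
      = ∑ a, ξ a i * ∑ k, ξ a k * B (stdVec k) (stdVec j) := by
        simp only [Finset.sum_mul, Finset.mul_sum]
        rw [Finset.sum_comm]
        simp only [mul_assoc]
    _ = (∑ a, B (stdVec j) (ξ a) • ξ a) i := by
        rw [WithLp.ofLp_sum, Finset.sum_apply]
        exact Finset.sum_congr rfl fun a _ ↦ by rw [h1, mul_comm]; rfl
    _ = (1 : Matrix (Fin n) (Fin n) ℝ) i j := by
        rw [sum_parseval_smul hpos hB]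
        simp [stdVec, Matrix.one_apply]

/-- Contraction of a bilinear form with `∑ ξ_a ξ_aᵀ`. -/
theorem sum_sum_mul_apply_stdVec
    (T : EuclideanSpace ℝ (Fin n) →ₗ[ℝ] EuclideanSpace ℝ (Fin n) →ₗ[ℝ] ℝ) :
    ∑ i, ∑ j, (∑ a, ξ a i * ξ a j) * T (stdVec i) (stdVec j) = ∑ a, T (ξ a) (ξ a) := by
  have h : ∀ v, T v v = ∑ i, ∑ j, (v i * v j) * T (stdVec i) (stdVec j) := fun v ↦ by
    conv_lhs => rw [← sum_apply_stdVec T v]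
    rw [LinearMap.sum_apply]
    refine Finset.sum_congr rfl fun i _ ↦ ?_
    rw [LinearMap.smul_apply, ← sum_apply_stdVec (T (stdVec i)) v, Finset.smul_sum]
    exact Finset.sum_congr rfl fun j _ ↦ by simp only [smul_eq_mul]; ring
  simp only [h, Finset.sum_mul]
  rw [Finset.sum_comm (γ := ι)]
  refine Finset.sum_congr rfl fun i _ ↦ ?_
  rw [Finset.sum_comm]

end Parseval

section Contraction

variable {ι : Type*} [Fintype ι] {n : ℕ} (ξ : ι → EuclideanSpace ℝ (Fin n))

/-- Contraction of `½ g^{kl} X_l d_k` for the inverse metric `∑ ξ_b ξ_bᵀ`. -/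
theorem sum_mul_contract (X d : Fin n → ℝ) :
    ∑ k, ((1 / 2 : ℝ) * ∑ l, (∑ b, ξ b k * ξ b l) * X l) * d k =
      ∑ b, (∑ k, ξ b k * d k) * ((1 / 2 : ℝ) * ∑ l, ξ b l * X l) := by
  have h : ∀ k, ∑ l, (∑ b, ξ b k * ξ b l) * X l = ∑ b, ξ b k * ∑ l, ξ b l * X l := fun k ↦ by
    simp only [Finset.sum_mul, Finset.mul_sum]
    rw [Finset.sum_comm]
    simp only [mul_assoc]
  simp only [h]
  simp only [Finset.mul_sum (s := (Finset.univ : Finset ι)), Finset.sum_mul]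
  rw [Finset.sum_comm]
  exact Finset.sum_congr rfl fun b _ ↦ Finset.sum_congr rfl fun k _ ↦ by ring

/-- Contraction of a coordinate expression `D - ∑ c_b (Christoffel terms)` with `∑ ξ_a ξ_aᵀ`; the
two Christoffel terms that are transposes of each other contribute equally. -/
theorem sum_sum_mul_hessian
    (D : EuclideanSpace ℝ (Fin n) →ₗ[ℝ] EuclideanSpace ℝ (Fin n) →ₗ[ℝ] ℝ)
    (T₁ T₂ : ι → EuclideanSpace ℝ (Fin n) →ₗ[ℝ] EuclideanSpace ℝ (Fin n) →ₗ[ℝ] ℝ) (c : ι → ℝ) :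
    ∑ i, ∑ j, (∑ a, ξ a i * ξ a j) * (D (stdVec i) (stdVec j) - ∑ b, c b * ((1 / 2 : ℝ) *
      (T₁ b (stdVec i) (stdVec j) + T₁ b (stdVec j) (stdVec i) - T₂ b (stdVec i) (stdVec j)))) =
    ∑ a, (D (ξ a) (ξ a) - ∑ b, c b *
      (T₁ b (ξ a) (ξ a) - (1 / 2 : ℝ) * T₂ b (ξ a) (ξ a))) := by
  have h := sum_sum_mul_apply_stdVec (ξ := ξ)
    (D - ∑ b, c b • (1 / 2 : ℝ) • (T₁ b + (T₁ b).flip - T₂ b))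
  simp only [LinearMap.sub_apply, LinearMap.sum_apply, LinearMap.smul_apply, LinearMap.add_apply,
    LinearMap.flip_apply, smul_eq_mul] at h
  rw [h]
  refine Finset.sum_congr rfl fun a _ ↦ ?_
  congr 1
  exact Finset.sum_congr rfl fun b _ ↦ by ring

/-- A continuous bilinear form as a bilinear form. -/
def toBilin (A : EuclideanSpace ℝ (Fin n) →L[ℝ] EuclideanSpace ℝ (Fin n) →L[ℝ] ℝ) :
    EuclideanSpace ℝ (Fin n) →ₗ[ℝ] EuclideanSpace ℝ (Fin n) →ₗ[ℝ] ℝ :=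
  LinearMap.mk₂ ℝ (fun v w ↦ A v w) (by simp) (by simp) (by simp) (by simp)

theorem toBilin_apply (A : EuclideanSpace ℝ (Fin n) →L[ℝ] EuclideanSpace ℝ (Fin n) →L[ℝ] ℝ)
    (v w : EuclideanSpace ℝ (Fin n)) : toBilin A v w = A v w := rfl

end Contraction

/-! ### Flows by isometries in coordinates -/

section Calculus

variable {E E' : Type*} [NormedAddCommGroup E] [NormedSpace ℝ E]
  [NormedAddCommGroup E'] [NormedSpace ℝ E']

/-- The velocity field at time `0` of a local flow. -/
def velocityField (F : ℝ × E → E') (y : E) : E' := fderiv ℝ F (0, y) (1, 0)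

/-- The derivative of the velocity field is the mixed second derivative of the flow. -/
def velocityFieldDeriv (F : ℝ × E → E') (y : E) : E →L[ℝ] E' :=
  ((fderiv ℝ (fderiv ℝ F) (0, y)).flip (1, 0)).comp (ContinuousLinearMap.inr ℝ ℝ E)

variable {F : ℝ × E → E'} {y₀ : E}

theorem hasFDerivAt_velocityField (hF : ContDiffAt ℝ 2 F (0, y₀)) :
    HasFDerivAt (velocityField F) (velocityFieldDeriv F y₀) y₀ := by
  have h1 : HasFDerivAt (fderiv ℝ F) (fderiv ℝ (fderiv ℝ F) (0, y₀)) (0, y₀) :=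
    ((hF.fderiv_right (m := 1) (by norm_num)).differentiableAt one_ne_zero).hasFDerivAt
  have h2 : HasFDerivAt (fun y : E ↦ ((0 : ℝ), y)) (ContinuousLinearMap.inr ℝ ℝ E) y₀ :=
    hasFDerivAt_prodMk_right 0 y₀
  have h3 := (h1.comp y₀ h2).clm_apply (hasFDerivAt_const ((1 : ℝ), (0 : E)) y₀)
  refine h3.congr_fderiv ?_
  ext v
  simp [velocityFieldDeriv]

theorem hasDerivAt_flow (hF : ContDiffAt ℝ 2 F (0, y₀)) :
    HasDerivAt (fun t ↦ F (t, y₀)) (velocityField F y₀) 0 := by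
  have h1 : HasFDerivAt F (fderiv ℝ F (0, y₀)) (0, y₀) :=
    (hF.differentiableAt two_ne_zero).hasFDerivAt
  exact h1.comp_hasDerivAt (f := fun t : ℝ ↦ (t, y₀)) 0
    ((hasDerivAt_id (0 : ℝ)).prodMk (hasDerivAt_const 0 y₀))

theorem eventually_fderiv_flow (hF : ContDiffAt ℝ 2 F (0, y₀)) :
    ∀ᶠ z in 𝓝 ((0 : ℝ), y₀), ∀ v,
      fderiv ℝ (fun y ↦ F (z.1, y)) z.2 v = fderiv ℝ F z (0, v) := by
  filter_upwards [hF.eventually (by simp)] with z hz v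
  have h1 : HasFDerivAt F (fderiv ℝ F (z.1, z.2)) (z.1, z.2) :=
    (hz.differentiableAt two_ne_zero).hasFDerivAt
  have h2 : HasFDerivAt (fun y ↦ F (z.1, y)) _ z.2 :=
    h1.comp (f := fun y ↦ (z.1, y)) z.2 (hasFDerivAt_prodMk_right z.1 z.2)
  rw [h2.fderiv]
  rfl

/-- Symmetry of second derivatives: the time derivative at `0` of the differential of the flow is
the differential of the velocity field. -/
theorem hasDerivAt_fderiv_flow (hF : ContDiffAt ℝ 2 F (0, y₀)) (v : E) :
    HasDerivAt (fun t ↦ fderiv ℝ (fun y ↦ F (t, y)) y₀ v) (velocityFieldDeriv F y₀ v) 0 := by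
  have h1 : HasFDerivAt (fderiv ℝ F) (fderiv ℝ (fderiv ℝ F) (0, y₀)) (0, y₀) :=
    ((hF.fderiv_right (m := 1) (by norm_num)).differentiableAt one_ne_zero).hasFDerivAt
  have h2 := h1.comp_hasDerivAt (f := fun t : ℝ ↦ (t, y₀)) 0
    ((hasDerivAt_id (0 : ℝ)).prodMk (hasDerivAt_const 0 y₀))
  have h3 := h2.clm_apply (hasDerivAt_const 0 ((0 : ℝ), v))
  have hsymm := hF.isSymmSndFDerivAt (by simp)
  have hc : ContinuousAt (fun t : ℝ ↦ (t, y₀)) 0 := by fun_prop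
  refine (h3.congr_of_eventuallyEq ?_).congr_deriv ?_
  · filter_upwards [hc.eventually (eventually_fderiv_flow hF)] with t ht
    simpa using ht v
  · have := hsymm (1, 0) (0, v)
    simp [velocityFieldDeriv, this]

set_option synthInstance.maxHeartbeats 200000 in
/-- Killing's equation for the velocity field of a flow by isometries. -/
theorem killing_equation {F : ℝ × E → E} {γ : E → E →L[ℝ] E →L[ℝ] ℝ} (hγ : DifferentiableAt ℝ γ y₀)
    (hF : ContDiffAt ℝ 2 F (0, y₀)) (h0 : ∀ᶠ y in 𝓝 y₀, F (0, y) = y)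
    (hiso : ∀ᶠ t in 𝓝 (0 : ℝ), ∀ v w, γ (F (t, y₀)) (fderiv ℝ (fun y ↦ F (t, y)) y₀ v)
      (fderiv ℝ (fun y ↦ F (t, y)) y₀ w) = γ y₀ v w) (v w : E) :
    fderiv ℝ γ y₀ (velocityField F y₀) v w + γ y₀ (velocityFieldDeriv F y₀ v) w
      + γ y₀ v (velocityFieldDeriv F y₀ w) = 0 := by
  have e0 : F (0, y₀) = y₀ := h0.self_of_nhds
  have e1 : ∀ v, fderiv ℝ (fun y ↦ F (0, y)) y₀ v = v := fun v ↦ by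
    rw [Filter.EventuallyEq.fderiv_eq (f := id) h0, fderiv_id]; rfl
  have hγ' : HasFDerivAt γ (fderiv ℝ γ y₀) (F (0, y₀)) := by rw [e0]; exact hγ.hasFDerivAt
  have h1 := HasFDerivAt.comp_hasDerivAt (l := γ) (l' := fderiv ℝ γ y₀) (f := fun t ↦ F (t, y₀)) (0 : ℝ) hγ'
    (hasDerivAt_flow hF)
  have h2 := (h1.clm_apply (hasDerivAt_fderiv_flow hF v)).clm_apply (hasDerivAt_fderiv_flow hF w)
  have h3 : HasDerivAt (fun _ : ℝ ↦ γ y₀ v w) 0 0 := hasDerivAt_const _ _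
  have h4 := (h3.congr_of_eventuallyEq (hiso.mono fun t ht ↦ ht v w)).unique h2
  simp only [Function.comp, e0, e1] at h4
  rw [h4]
  simp [add_assoc]

end Calculus

/-! ### The metric and the Laplacian in a chart -/

section Chart

variable {n : ℕ} {M : Type*} [TopologicalSpace M]
  [ChartedSpace (EuclideanSpace ℝ (Fin n)) M] [IsManifold (𝓡 n) ∞ M]

/-- The metric read in the chart at `x`, as a function from coordinates to bilinear forms. -/
def chartMetric (g : RiemMetric n M) (x : M) (y : EuclideanSpace ℝ (Fin n)) :
    EuclideanSpace ℝ (Fin n) →L[ℝ] EuclideanSpace ℝ (Fin n) →L[ℝ] ℝ :=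
  ContinuousLinearMap.bilinearComp (E := EuclideanSpace ℝ (Fin n))
    (F := EuclideanSpace ℝ (Fin n)) (g.inner ((extChartAt (𝓡 n) x).symm y))
    (mfderiv 𝓘(ℝ, EuclideanSpace ℝ (Fin n)) (𝓡 n) (extChartAt (𝓡 n) x).symm y)
    (mfderiv 𝓘(ℝ, EuclideanSpace ℝ (Fin n)) (𝓡 n) (extChartAt (𝓡 n) x).symm y)

theorem chartMetric_apply (g : RiemMetric n M) (x : M) (y u v : EuclideanSpace ℝ (Fin n)) :
    chartMetric g x y u v = g.inner ((extChartAt (𝓡 n) x).symm y)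
      (mfderiv 𝓘(ℝ, EuclideanSpace ℝ (Fin n)) (𝓡 n) (extChartAt (𝓡 n) x).symm y u)
      (mfderiv 𝓘(ℝ, EuclideanSpace ℝ (Fin n)) (𝓡 n) (extChartAt (𝓡 n) x).symm y v) := rfl

theorem gram_eq_chartMetric (g : RiemMetric n M) (x : M) (y : EuclideanSpace ℝ (Fin n)) :
    gram g x y = Matrix.of fun i j ↦ chartMetric g x y (stdVec i) (stdVec j) := rfl

theorem chartMetric_symm (g : RiemMetric n M) (x : M) (y u v : EuclideanSpace ℝ (Fin n)) :
    chartMetric g x y u v = chartMetric g x y v u := by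
  rw [chartMetric_apply, chartMetric_apply]; exact g.symm _ _ _

/-- The derivative of the inverse chart is injective. -/
theorem mfderiv_extChartAt_symm_ne_zero (x : M) {y : EuclideanSpace ℝ (Fin n)}
    (hy : y ∈ (extChartAt (𝓡 n) x).target) {v : EuclideanSpace ℝ (Fin n)} (hv : v ≠ 0) :
    mfderiv 𝓘(ℝ, EuclideanSpace ℝ (Fin n)) (𝓡 n) (extChartAt (𝓡 n) x).symm y v ≠ 0 := by
  intro h0
  have h := mfderiv_extChartAt_comp_mfderivWithin_extChartAt_symm (I := 𝓡 n) (x := x) hy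
  rw [modelWithCornersSelf_coe, range_id, mfderivWithin_univ] at h
  apply hv
  have h2 := congrArg (fun A : EuclideanSpace ℝ (Fin n) →L[ℝ] EuclideanSpace ℝ (Fin n) ↦ A v) h
  refine Eq.trans (Eq.symm h2) ?_
  refine (congrArg (mfderiv (𝓡 n) 𝓘(ℝ, EuclideanSpace ℝ (Fin n)) (extChartAt (𝓡 n) x)
    ((extChartAt (𝓡 n) x).symm y)) h0).trans (map_zero _)

theorem chartMetric_pos (g : RiemMetric n M) (x : M) {y : EuclideanSpace ℝ (Fin n)}
    (hy : y ∈ (extChartAt (𝓡 n) x).target) {v : EuclideanSpace ℝ (Fin n)} (hv : v ≠ 0) :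
    0 < chartMetric g x y v v :=
  g.pos _ _ (mfderiv_extChartAt_symm_ne_zero x hy hv)

/-- The metric is smooth in the chart. -/
theorem contDiffOn_chartMetric (g : RiemMetric n M) (x : M) :
    ContDiffOn ℝ ∞ (chartMetric g x) (extChartAt (𝓡 n) x).target := by
  refine contDiffOn_clm_apply.2 fun u ↦ contDiffOn_clm_apply.2 fun v ↦ ?_
  intro y hy
  refine ContDiffAt.contDiffWithinAt ?_
  set ψ := (extChartAt (𝓡 n) x).symm with hψ
  have hsec : ∀ w : EuclideanSpace ℝ (Fin n),
      ContMDiffAt 𝓘(ℝ, EuclideanSpace ℝ (Fin n)) ((𝓡 n).prod 𝓘(ℝ, EuclideanSpace ℝ (Fin n))) ∞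
        (fun z ↦ (TotalSpace.mk' (EuclideanSpace ℝ (Fin n)) (ψ z)
          (mfderiv 𝓘(ℝ, EuclideanSpace ℝ (Fin n)) (𝓡 n) ψ z w :
            TangentSpace (𝓡 n) (ψ z)) : TangentBundle (𝓡 n) M)) y := by
    intro w
    have ho := isOpen_extChartAt_target (I := 𝓡 n) x
    have h1 := (contMDiffOn_extChartAt_symm (I := 𝓡 n) (n := ∞) x).contMDiffOn_tangentMapWithin
      (m := ∞) (by simp) ho.uniqueMDiffOn
    have h2 : ContMDiffAt 𝓘(ℝ, EuclideanSpace ℝ (Fin n))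
        (𝓘(ℝ, EuclideanSpace ℝ (Fin n)).prod 𝓘(ℝ, EuclideanSpace ℝ (Fin n))) ∞
        (fun z ↦ (⟨z, w⟩ : TangentBundle 𝓘(ℝ, EuclideanSpace ℝ (Fin n))
          (EuclideanSpace ℝ (Fin n)))) y :=
      contMDiffAt_vectorSpace_iff_contDiffAt.2 contDiffAt_const
    have hmem : (TotalSpace.proj ⁻¹' (extChartAt (𝓡 n) x).target :
        Set (TangentBundle 𝓘(ℝ, EuclideanSpace ℝ (Fin n)) (EuclideanSpace ℝ (Fin n)))) ∈
        𝓝 (⟨y, w⟩ : TangentBundle 𝓘(ℝ, EuclideanSpace ℝ (Fin n)) (EuclideanSpace ℝ (Fin n))) :=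
      (FiberBundle.continuous_proj (EuclideanSpace ℝ (Fin n)) _).continuousAt.preimage_mem_nhds
        (ho.mem_nhds hy)
    refine (ContMDiffAt.comp y (h1.contMDiffAt hmem) h2).congr_of_eventuallyEq ?_
    filter_upwards [ho.mem_nhds hy] with z hz
    simp only [Function.comp, tangentMapWithin, mfderivWithin_of_isOpen ho hz]
    rfl
  have hb : ContMDiffAt 𝓘(ℝ, EuclideanSpace ℝ (Fin n)) (𝓡 n) ∞ ψ y :=
    (contMDiffOn_extChartAt_symm x).contMDiffAt ((isOpen_extChartAt_target x).mem_nhds hy)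
  have key : ContMDiffAt 𝓘(ℝ, EuclideanSpace ℝ (Fin n)) ((𝓡 n).prod 𝓘(ℝ)) ∞
      (fun z ↦ TotalSpace.mk' ℝ (E := Bundle.Trivial M ℝ) (ψ z) (g.inner (ψ z)
        (mfderiv 𝓘(ℝ, EuclideanSpace ℝ (Fin n)) (𝓡 n) ψ z u)
        (mfderiv 𝓘(ℝ, EuclideanSpace ℝ (Fin n)) (𝓡 n) ψ z v))) y := by
    rw [← contMDiffWithinAt_univ]
    apply ContMDiffWithinAt.clm_bundle_apply₂ (F₁ := EuclideanSpace ℝ (Fin n))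
      (F₂ := EuclideanSpace ℝ (Fin n))
    · exact (ContMDiffAt.comp y g.contMDiff.contMDiffAt hb).contMDiffWithinAt
    · exact (hsec u).contMDiffWithinAt
    · exact (hsec v).contMDiffWithinAt
  rw [contMDiffAt_totalSpace] at key
  exact key.2.contDiffAt

theorem differentiableAt_chartMetric (g : RiemMetric n M) (x : M) :
    DifferentiableAt ℝ (chartMetric g x) (extChartAt (𝓡 n) x x) :=
  ((contDiffOn_chartMetric g x).contDiffAt
    (extChartAt_target_mem_nhds x)).differentiableAt (by simp)

set_option synthInstance.maxHeartbeats 200000 in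
/-- The Laplacian in the chart at `x`, with the inverse metric expressed by a family of vectors
satisfying Parseval's identity. -/
theorem laplacian_eq_sum_parseval {ι : Type*} [Fintype ι] (g : RiemMetric n M) (f : M → ℝ) (x : M)
    {y : EuclideanSpace ℝ (Fin n)} (hy : y = extChartAt (𝓡 n) x x)
    {u : EuclideanSpace ℝ (Fin n) → ℝ} (hu : u = f ∘ (extChartAt (𝓡 n) x).symm)
    (hu2 : ContDiffAt ℝ 2 u y) (ξ : ι → EuclideanSpace ℝ (Fin n))
    (hξ : ∀ v w, chartMetric g x y v w =
      ∑ a, chartMetric g x y v (ξ a) * chartMetric g x y w (ξ a)) :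
    laplacian g f x = ∑ a, (fderiv ℝ (fderiv ℝ u) y (ξ a) (ξ a)
      - ∑ b, fderiv ℝ u y (ξ b) * (fderiv ℝ (chartMetric g x) y (ξ a) (ξ a) (ξ b)
        - (1 / 2 : ℝ) * fderiv ℝ (chartMetric g x) y (ξ b) (ξ a) (ξ a))) := by
  have hpos : ∀ v, v ≠ 0 → 0 < chartMetric g x y v v := fun v hv ↦
    chartMetric_pos g x (by rw [hy]; exact mem_extChartAt_target x) hv
  have hinv := inv_gram_eq_sum hpos hξ
  rw [← gram_eq_chartMetric] at hinv
  have hγ : DifferentiableAt ℝ (chartMetric g x) y := by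
    rw [hy]; exact differentiableAt_chartMetric g x
  have hpg : ∀ i j k, pderiv k (fun z ↦ gram g x z i j) y =
      fderiv ℝ (chartMetric g x) y (stdVec k) (stdVec i) (stdVec j) := fun i j k ↦ by
    have h := ((hγ.hasFDerivAt.clm_apply (hasFDerivAt_const (stdVec i) y)).clm_apply
      (hasFDerivAt_const (stdVec j) y)).fderiv
    rw [pderiv]
    refine (congrArg (fun A : EuclideanSpace ℝ (Fin n) →L[ℝ] ℝ ↦ A (stdVec k)) h).trans ?_
    simp
  have hpu : ∀ i j, pderiv i (pderiv j u) y =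
      fderiv ℝ (fderiv ℝ u) y (stdVec i) (stdVec j) := fun i j ↦ by
    have h1 : HasFDerivAt (fderiv ℝ u) (fderiv ℝ (fderiv ℝ u) y) y :=
      ((hu2.fderiv_right (m := 1) (by norm_num)).differentiableAt one_ne_zero).hasFDerivAt
    have h := (h1.clm_apply (hasFDerivAt_const (stdVec j) y)).fderiv
    rw [pderiv]
    refine (congrArg (fun A : EuclideanSpace ℝ (Fin n) →L[ℝ] ℝ ↦ A (stdVec i)) h).trans ?_
    simp
  set T := fderiv ℝ (chartMetric g x) y with hT
  have hchr : ∀ i j, ∑ k, christoffel g x k i j y * pderiv k u y =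
      ∑ b, fderiv ℝ u y (ξ b) * ((1 / 2 : ℝ) * (T (stdVec i) (stdVec j) (ξ b)
        + T (stdVec j) (stdVec i) (ξ b) - T (ξ b) (stdVec i) (stdVec j))) := fun i j ↦ by
    have e1 : ∀ b, ∑ l, ξ b l * (T (stdVec i) (stdVec j) (stdVec l)
        + T (stdVec j) (stdVec i) (stdVec l) - T (stdVec l) (stdVec i) (stdVec j)) =
        T (stdVec i) (stdVec j) (ξ b) + T (stdVec j) (stdVec i) (ξ b)
          - T (ξ b) (stdVec i) (stdVec j) := fun b ↦
      sum_apply_stdVec ((T (stdVec i) (stdVec j)).toLinearMap + (T (stdVec j) (stdVec i)).toLinearMap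
        - ((T.flip (stdVec i)).flip (stdVec j)).toLinearMap) (ξ b)
    have e2 : ∀ b, ∑ k, ξ b k * pderiv k u y = fderiv ℝ u y (ξ b) := fun b ↦
      sum_apply_stdVec (fderiv ℝ u y).toLinearMap (ξ b)
    simp only [christoffel, hinv, hpg, Matrix.of_apply, ← e1, ← e2]
    exact sum_mul_contract ξ _ _
  have hT1 : ∀ b, ∃ T₁ : EuclideanSpace ℝ (Fin n) →ₗ[ℝ] EuclideanSpace ℝ (Fin n) →ₗ[ℝ] ℝ,
      ∀ v w, T₁ v w = T v w (ξ b) := fun b ↦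
    ⟨LinearMap.mk₂ ℝ (fun v w ↦ T v w (ξ b)) (by simp) (by simp) (by simp) (by simp),
      fun _ _ ↦ rfl⟩
  choose T₁ hT₁ using hT1
  have h := sum_sum_mul_hessian ξ (toBilin (fderiv ℝ (fderiv ℝ u) y)) T₁
    (fun b ↦ toBilin (T (ξ b))) (fun b ↦ fderiv ℝ u y (ξ b))
  simp only [hT₁, toBilin_apply] at h
  simp only [laplacian, ← hy, ← hu, hinv, Matrix.of_apply, hpu, hchr]
  exact h

end Chart

/-! ### The Laplacian in terms of flows by isometries -/

section Flow

variable {n : ℕ} {M : Type*} [TopologicalSpace M]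
  [ChartedSpace (EuclideanSpace ℝ (Fin n)) M]

/-- The velocity at time `0` of a curve. It is a tangent vector at `c 0`; the type forgets the base
point, so that curves with propositionally equal base points can be compared. -/
def velocity (c : ℝ → M) : EuclideanSpace ℝ (Fin n) :=
  (mfderiv 𝓘(ℝ, ℝ) (𝓡 n) c 0 : ℝ →L[ℝ] EuclideanSpace ℝ (Fin n)) 1

theorem velocity_congr {c c' : ℝ → M} (h : c =ᶠ[𝓝 0] c') :
    velocity (n := n) c = velocity c' := by
  have h1 := h.mfderiv_eq (I := 𝓘(ℝ, ℝ)) (I' := 𝓡 n)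
  exact congrArg (fun A : ℝ →L[ℝ] EuclideanSpace ℝ (Fin n) ↦ A 1) h1

theorem velocity_comp {m : ℕ} {N : Type*} [TopologicalSpace N]
    [ChartedSpace (EuclideanSpace ℝ (Fin m)) N] {q : M → N} {c : ℝ → M}
    (hq : MDifferentiableAt (𝓡 n) (𝓡 m) q (c 0)) (hc : MDifferentiableAt 𝓘(ℝ, ℝ) (𝓡 n) c 0) :
    velocity (n := m) (fun t ↦ q (c t)) =
      (mfderiv (𝓡 n) (𝓡 m) q (c 0) :
        EuclideanSpace ℝ (Fin n) →L[ℝ] EuclideanSpace ℝ (Fin m)) (velocity c) := by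
  have h := mfderiv_comp (0 : ℝ) (f := c) (g := q) hq hc
  exact congrArg (fun A : ℝ →L[ℝ] EuclideanSpace ℝ (Fin m) ↦ A 1) h

/-- A local flow read in the chart at `x`. -/
def chartFlow (x : M) (θ : ℝ → M → M) (z : ℝ × EuclideanSpace ℝ (Fin n)) :
    EuclideanSpace ℝ (Fin n) :=
  extChartAt (𝓡 n) x (θ z.1 ((extChartAt (𝓡 n) x).symm z.2))

variable {x : M} {θ : ℝ → M → M}

theorem eventually_chartFlow_zero (h0 : ∀ y, θ 0 y = y) :
    ∀ᶠ y in 𝓝 (extChartAt (𝓡 n) x x), chartFlow x θ (0, y) = y := by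
  filter_upwards [extChartAt_target_mem_nhds (I := 𝓡 n) x] with y hy
  rw [chartFlow, h0]
  exact (extChartAt (𝓡 n) x).right_inv hy

theorem eventually_symm_chartFlow
    (hθ : ContMDiffAt (𝓘(ℝ, ℝ).prod (𝓡 n)) (𝓡 n) ∞ (fun z : ℝ × M ↦ θ z.1 z.2) (0, x))
    (h0 : ∀ y, θ 0 y = y) :
    ∀ᶠ z in 𝓝 ((0 : ℝ), extChartAt (𝓡 n) x x),
      θ z.1 ((extChartAt (𝓡 n) x).symm z.2) ∈ (extChartAt (𝓡 n) x).source ∧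
      (extChartAt (𝓡 n) x).symm (chartFlow x θ z) =
        θ z.1 ((extChartAt (𝓡 n) x).symm z.2) := by
  have e : (extChartAt (𝓡 n) x).symm (extChartAt (𝓡 n) x x) = x := extChartAt_to_inv x
  have hc : ContinuousAt (fun z : ℝ × EuclideanSpace ℝ (Fin n) ↦
      θ z.1 ((extChartAt (𝓡 n) x).symm z.2)) (0, extChartAt (𝓡 n) x x) := by
    have h1 : ContinuousAt (fun z : ℝ × EuclideanSpace ℝ (Fin n) ↦
        (z.1, (extChartAt (𝓡 n) x).symm z.2)) (0, extChartAt (𝓡 n) x x) :=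
      continuousAt_fst.prodMk
        (ContinuousAt.comp (g := (extChartAt (𝓡 n) x).symm) (continuousAt_extChartAt_symm x)
          continuousAt_snd)
    exact ContinuousAt.comp_of_eq (g := fun z : ℝ × M ↦ θ z.1 z.2) hθ.continuousAt h1 (by simp)
  have hmem := hc.eventually_mem (s := (extChartAt (𝓡 n) x).source)
    (by simpa [h0, e] using extChartAt_source_mem_nhds (I := 𝓡 n) x)
  filter_upwards [hmem] with z hz
  exact ⟨hz, (extChartAt (𝓡 n) x).left_inv hz⟩

theorem eventually_symm_chartFlow_time
    (hθ : ContMDiffAt (𝓘(ℝ, ℝ).prod (𝓡 n)) (𝓡 n) ∞ (fun z : ℝ × M ↦ θ z.1 z.2) (0, x))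
    (h0 : ∀ y, θ 0 y = y) :
    ∀ᶠ t in 𝓝 (0 : ℝ), (extChartAt (𝓡 n) x).symm (chartFlow x θ (t, extChartAt (𝓡 n) x x)) =
        θ t x := by
  have hc : ContinuousAt (fun t : ℝ ↦ (t, extChartAt (𝓡 n) x x)) 0 := by fun_prop
  filter_upwards [hc.eventually (eventually_symm_chartFlow hθ h0)] with t ht
  rw [ht.2, extChartAt_to_inv]

variable [IsManifold (𝓡 n) ∞ M]

/-- The squared length of the velocity at time `0` of a curve. -/
def speedSq (g : RiemMetric n M) (c : ℝ → M) : ℝ := g.inner (c 0) (velocity c) (velocity c)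

variable {g : RiemMetric n M}

theorem inner_congr_base (g : RiemMetric n M) {p q : M} (h : p = q)
    {u u' v v' : EuclideanSpace ℝ (Fin n)} (hu : u = u') (hv : v = v') :
    g.inner p u v = g.inner q u' v' := by
  subst h hu hv; rfl

theorem contDiffAt_chartFlow
    (hθ : ContMDiffAt (𝓘(ℝ, ℝ).prod (𝓡 n)) (𝓡 n) ∞ (fun z : ℝ × M ↦ θ z.1 z.2) (0, x))
    (h0 : ∀ y, θ 0 y = y) :
    ContDiffAt ℝ 2 (chartFlow x θ) (0, extChartAt (𝓡 n) x x) := by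
  have e : (extChartAt (𝓡 n) x).symm (extChartAt (𝓡 n) x x) = x := extChartAt_to_inv x
  have h1 : ContMDiffAt 𝓘(ℝ, EuclideanSpace ℝ (Fin n)) (𝓡 n) ∞ (extChartAt (𝓡 n) x).symm
      (extChartAt (𝓡 n) x x) :=
    (contMDiffOn_extChartAt_symm x).contMDiffAt (extChartAt_target_mem_nhds x)
  have h2 : ContMDiffAt (𝓘(ℝ, ℝ).prod 𝓘(ℝ, EuclideanSpace ℝ (Fin n))) (𝓘(ℝ, ℝ).prod (𝓡 n)) ∞
      (fun z : ℝ × EuclideanSpace ℝ (Fin n) ↦ (z.1, (extChartAt (𝓡 n) x).symm z.2))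
      (0, extChartAt (𝓡 n) x x) :=
    contMDiffAt_fst.prodMk (ContMDiffAt.comp (0, extChartAt (𝓡 n) x x) h1 contMDiffAt_snd)
  have h3 := ContMDiffAt.comp_of_eq hθ h2 (by simp)
  have h4 : ContMDiffAt (𝓡 n) 𝓘(ℝ, EuclideanSpace ℝ (Fin n)) ∞ (extChartAt (𝓡 n) x) x :=
    contMDiffAt_extChartAt
  have h5 := ContMDiffAt.comp_of_eq h4 h3 (by simp [h0])
  rw [← modelWithCornersSelf_prod, chartedSpaceSelf_prod] at h5
  exact h5.contDiffAt.of_le ENat.LEInfty.out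

/-- Near `x`, the velocity of a flow line corresponds to the velocity field of the flow in the
chart. -/
theorem eventually_velocity_eq
    (hθ : ContMDiffAt (𝓘(ℝ, ℝ).prod (𝓡 n)) (𝓡 n) ∞ (fun z : ℝ × M ↦ θ z.1 z.2) (0, x))
    (h0 : ∀ y, θ 0 y = y) :
    ∀ᶠ y in 𝓝 (extChartAt (𝓡 n) x x),
      velocity (n := n) (fun t ↦ θ t ((extChartAt (𝓡 n) x).symm y)) =
        (mfderiv 𝓘(ℝ, EuclideanSpace ℝ (Fin n)) (𝓡 n) (extChartAt (𝓡 n) x).symm y :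
          EuclideanSpace ℝ (Fin n) →L[ℝ] EuclideanSpace ℝ (Fin n))
          (velocityField (chartFlow x θ) y) := by
  have hc : ContinuousAt (fun y : EuclideanSpace ℝ (Fin n) ↦ ((0 : ℝ), y)) (extChartAt (𝓡 n) x x) :=
    by fun_prop
  have hF := (contDiffAt_chartFlow hθ h0).eventually (by simp)
  filter_upwards [hc.eventually (eventually_symm_chartFlow hθ h0).eventually_nhds, hc.eventually hF,
    extChartAt_target_mem_nhds (I := 𝓡 n) x, eventually_chartFlow_zero h0] with y h1 h2 hy h3
  have hct : ContinuousAt (fun t : ℝ ↦ (t, y)) 0 := by fun_prop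
  have h4 : (fun t ↦ θ t ((extChartAt (𝓡 n) x).symm y)) =ᶠ[𝓝 0]
      fun t ↦ (extChartAt (𝓡 n) x).symm (chartFlow x θ (t, y)) := by
    filter_upwards [hct.eventually h1] with t ht
    exact ht.2.symm
  rw [velocity_congr h4]
  have h5 : HasDerivAt (fun t ↦ chartFlow x θ (t, y)) (velocityField (chartFlow x θ) y) 0 :=
    hasDerivAt_flow h2
  have h6 : MDifferentiableAt (𝓡 n) (𝓡 n) (extChartAt (𝓡 n) x).symm (chartFlow x θ (0, y)) := by
    rw [h3]
    exact ((contMDiffOn_extChartAt_symm (n := ∞) x).contMDiffAt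
      ((isOpen_extChartAt_target x).mem_nhds hy)).mdifferentiableAt (by simp)
  rw [velocity_comp (q := (extChartAt (𝓡 n) x).symm) (c := fun t ↦ chartFlow x θ (t, y)) h6
    h5.differentiableAt.mdifferentiableAt, h3]
  congr 1
  rw [velocity, mfderiv_eq_fderiv]
  exact h5.hasFDerivAt.fderiv ▸ (one_smul ℝ _)

theorem eventually_speedSq_eq
    (hθ : ContMDiffAt (𝓘(ℝ, ℝ).prod (𝓡 n)) (𝓡 n) ∞ (fun z : ℝ × M ↦ θ z.1 z.2) (0, x))
    (h0 : ∀ y, θ 0 y = y) :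
    ∀ᶠ y in 𝓝 (extChartAt (𝓡 n) x x),
      speedSq g (fun t ↦ θ t ((extChartAt (𝓡 n) x).symm y)) =
        chartMetric g x y (velocityField (chartFlow x θ) y) (velocityField (chartFlow x θ) y) := by
  filter_upwards [eventually_velocity_eq hθ h0] with y hy
  rw [speedSq, chartMetric_apply]
  exact inner_congr_base g (h0 _) hy hy

/-- A flow by isometries is a flow by isometries in the chart. -/
theorem eventually_isometry_chartFlow
    (hθ : ContMDiffAt (𝓘(ℝ, ℝ).prod (𝓡 n)) (𝓡 n) ∞ (fun z : ℝ × M ↦ θ z.1 z.2) (0, x))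
    (h0 : ∀ y, θ 0 y = y) (hd : ∀ t, MDifferentiable (𝓡 n) (𝓡 n) (θ t))
    (hiso : ∀ t y (u v : TangentSpace (𝓡 n) y),
      g.inner (θ t y) (mfderiv (𝓡 n) (𝓡 n) (θ t) y u) (mfderiv (𝓡 n) (𝓡 n) (θ t) y v) =
        g.inner y u v) :
    ∀ᶠ t in 𝓝 (0 : ℝ), ∀ v w, chartMetric g x (chartFlow x θ (t, extChartAt (𝓡 n) x x))
      (fderiv ℝ (fun y ↦ chartFlow x θ (t, y)) (extChartAt (𝓡 n) x x) v)
      (fderiv ℝ (fun y ↦ chartFlow x θ (t, y)) (extChartAt (𝓡 n) x x) w) =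
        chartMetric g x (extChartAt (𝓡 n) x x) v w := by
  set y₀ := extChartAt (𝓡 n) x x with hy₀
  set ψ := (extChartAt (𝓡 n) x).symm with hψ
  have hc : ContinuousAt (fun t : ℝ ↦ (t, y₀)) 0 := by fun_prop
  have hF := (contDiffAt_chartFlow hθ h0).eventually (by simp)
  filter_upwards [hc.eventually (eventually_symm_chartFlow hθ h0).eventually_nhds,
    hc.eventually hF] with t h1 h2 v w
  have hct : ContinuousAt (fun y ↦ (t, y)) y₀ := by fun_prop
  have h3 : (fun y ↦ ψ (chartFlow x θ (t, y))) =ᶠ[𝓝 y₀] fun y ↦ θ t (ψ y) := by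
    filter_upwards [hct.eventually h1] with y hy
    exact hy.2
  have hmem : chartFlow x θ (t, y₀) ∈ (extChartAt (𝓡 n) x).target :=
    (extChartAt (𝓡 n) x).map_source h1.self_of_nhds.1
  have hψd : ∀ y ∈ (extChartAt (𝓡 n) x).target,
      MDifferentiableAt 𝓘(ℝ, EuclideanSpace ℝ (Fin n)) (𝓡 n) ψ y := fun y hy ↦
    ((contMDiffOn_extChartAt_symm (n := ∞) x).contMDiffAt
      ((isOpen_extChartAt_target x).mem_nhds hy)).mdifferentiableAt (by simp)
  have hFd : DifferentiableAt ℝ (fun y ↦ chartFlow x θ (t, y)) y₀ :=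
    (h2.differentiableAt two_ne_zero).comp y₀ (by fun_prop)
  have e1 := mfderiv_comp y₀ (f := fun y ↦ chartFlow x θ (t, y)) (g := ψ) (hψd _ hmem)
    hFd.mdifferentiableAt
  have e2 := mfderiv_comp y₀ (f := ψ) (g := θ t) (hd t _) (hψd _ (mem_extChartAt_target x))
  have e3 := h3.mfderiv_eq (I := 𝓘(ℝ, EuclideanSpace ℝ (Fin n))) (I' := 𝓡 n)
  rw [mfderiv_eq_fderiv] at e1
  have e4 : ∀ v : EuclideanSpace ℝ (Fin n),
      (mfderiv 𝓘(ℝ, EuclideanSpace ℝ (Fin n)) (𝓡 n) ψ (chartFlow x θ (t, y₀))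
        (fderiv ℝ (fun y ↦ chartFlow x θ (t, y)) y₀ v) : EuclideanSpace ℝ (Fin n)) =
      mfderiv (𝓡 n) (𝓡 n) (θ t) (ψ y₀)
        (mfderiv 𝓘(ℝ, EuclideanSpace ℝ (Fin n)) (𝓡 n) ψ y₀ v) := fun v ↦ by
    have := (e1.symm.trans (e3.trans e2))
    exact congrArg (fun A : EuclideanSpace ℝ (Fin n) →L[ℝ] EuclideanSpace ℝ (Fin n) ↦ A v) this
  rw [chartMetric_apply, chartMetric_apply]
  exact (inner_congr_base g h1.self_of_nhds.2 (e4 v) (e4 w)).trans (hiso t (ψ y₀) _ _)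

theorem contDiffAt_comp_extChartAt_symm {f : M → ℝ} (hf : ContMDiffAt (𝓡 n) 𝓘(ℝ, ℝ) 2 f x) :
    ContDiffAt ℝ 2 (f ∘ (extChartAt (𝓡 n) x).symm) (extChartAt (𝓡 n) x x) := by
  have h1 : ContMDiffAt 𝓘(ℝ, EuclideanSpace ℝ (Fin n)) (𝓡 n) 2 (extChartAt (𝓡 n) x).symm
      (extChartAt (𝓡 n) x x) :=
    ((contMDiffOn_extChartAt_symm (n := ∞) x).contMDiffAt
      (extChartAt_target_mem_nhds x)).of_le ENat.LEInfty.out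
  exact (ContMDiffAt.comp_of_eq hf h1 (extChartAt_to_inv x)).contDiffAt

/-- The derivative of a function along the flow. -/
theorem eventually_deriv_flow_eq {f : M → ℝ} (hf : ContMDiffAt (𝓡 n) 𝓘(ℝ, ℝ) 2 f x)
    (hθ : ContMDiffAt (𝓘(ℝ, ℝ).prod (𝓡 n)) (𝓡 n) ∞ (fun z : ℝ × M ↦ θ z.1 z.2) (0, x))
    (h0 : ∀ y, θ 0 y = y) :
    ∀ᶠ y in 𝓝 (extChartAt (𝓡 n) x x),
      deriv (fun t ↦ f (θ t ((extChartAt (𝓡 n) x).symm y))) 0 =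
        fderiv ℝ (f ∘ (extChartAt (𝓡 n) x).symm) y (velocityField (chartFlow x θ) y) := by
  have hu := contDiffAt_comp_extChartAt_symm hf
  have hc : ContinuousAt (fun y : EuclideanSpace ℝ (Fin n) ↦ ((0 : ℝ), y)) (extChartAt (𝓡 n) x x) :=
    by fun_prop
  have hF := (contDiffAt_chartFlow hθ h0).eventually (by simp)
  filter_upwards [hc.eventually (eventually_symm_chartFlow hθ h0).eventually_nhds, hc.eventually hF,
    hu.eventually (by simp), eventually_chartFlow_zero h0] with y h1 h2 h3 h4
  have hct : ContinuousAt (fun t : ℝ ↦ (t, y)) 0 := by fun_prop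
  have h5 : (fun t ↦ f (θ t ((extChartAt (𝓡 n) x).symm y))) =ᶠ[𝓝 0]
      fun t ↦ (f ∘ (extChartAt (𝓡 n) x).symm) (chartFlow x θ (t, y)) := by
    filter_upwards [hct.eventually h1] with t ht
    exact congrArg f ht.2.symm
  rw [h5.deriv_eq]
  have h6 : HasDerivAt (fun t ↦ chartFlow x θ (t, y)) (velocityField (chartFlow x θ) y) 0 :=
    hasDerivAt_flow h2
  have h7 : HasFDerivAt (f ∘ (extChartAt (𝓡 n) x).symm)
      (fderiv ℝ (f ∘ (extChartAt (𝓡 n) x).symm) y) (chartFlow x θ (0, y)) := by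
    rw [h4]; exact (h3.differentiableAt two_ne_zero).hasFDerivAt
  exact (h7.comp_hasDerivAt (f := fun t ↦ chartFlow x θ (t, y)) 0 h6).deriv

set_option synthInstance.maxHeartbeats 200000 in
/-- The Laplacian at `x` in terms of flows by isometries whose velocities `ξ_a` at `x` satisfy
Parseval's identity: `Δ f = ∑_a (ξ_a ξ_a f + ½ ∑_b (ξ_b |ξ_a|²) (ξ_b f))`. By Killing's equation
`∇_ξ ξ = -½ grad |ξ|²`, so that each term is the Hessian of `f` on the pair `ξ_a`, `ξ_a`. -/
theorem laplacian_eq_sum_flows {ι : Type*} [Fintype ι] (g : RiemMetric n M) {x : M} {f : M → ℝ}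
    (hf : ContMDiffAt (𝓡 n) 𝓘(ℝ, ℝ) 2 f x) {Θ : ι → ℝ → M → M}
    (hΘ : ∀ a, ContMDiffAt (𝓘(ℝ, ℝ).prod (𝓡 n)) (𝓡 n) ∞ (fun z : ℝ × M ↦ Θ a z.1 z.2) (0, x))
    (h0 : ∀ a y, Θ a 0 y = y) (hd : ∀ a t, MDifferentiable (𝓡 n) (𝓡 n) (Θ a t))
    (hiso : ∀ a t y (u v : TangentSpace (𝓡 n) y),
      g.inner (Θ a t y) (mfderiv (𝓡 n) (𝓡 n) (Θ a t) y u) (mfderiv (𝓡 n) (𝓡 n) (Θ a t) y v) =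
        g.inner y u v)
    (hpars : ∀ u v : EuclideanSpace ℝ (Fin n), g.inner x u v =
      ∑ a, g.inner x u (velocity fun t ↦ Θ a t x) * g.inner x v (velocity fun t ↦ Θ a t x)) :
    laplacian g f x = ∑ a, (deriv (fun s ↦ deriv (fun t ↦ f (Θ a t (Θ a s x))) 0) 0 +
      ∑ b, (1 / 2 : ℝ) * deriv (fun t ↦ speedSq g (fun s ↦ Θ a s (Θ b t x))) 0 *
        deriv (fun t ↦ f (Θ b t x)) 0) := by
  obtain ⟨y₀, hy₀⟩ : ∃ y₀, y₀ = extChartAt (𝓡 n) x x := ⟨_, rfl⟩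
  obtain ⟨u, hu⟩ : ∃ u, u = f ∘ (extChartAt (𝓡 n) x).symm := ⟨_, rfl⟩
  have e : (extChartAt (𝓡 n) x).symm y₀ = x := by rw [hy₀]; exact extChartAt_to_inv x
  have hu2 : ContDiffAt ℝ 2 u y₀ := by rw [hu, hy₀]; exact contDiffAt_comp_extChartAt_symm hf
  let F : ι → ℝ × EuclideanSpace ℝ (Fin n) → EuclideanSpace ℝ (Fin n) := fun a ↦ chartFlow x (Θ a)
  let ξ : ι → EuclideanSpace ℝ (Fin n) := fun a ↦ velocityField (F a) y₀
  let D : ι → EuclideanSpace ℝ (Fin n) →L[ℝ] EuclideanSpace ℝ (Fin n) :=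
    fun a ↦ velocityFieldDeriv (F a) y₀
  let γ := chartMetric g x
  have hF : ∀ a, ContDiffAt ℝ 2 (F a) (0, y₀) := fun a ↦ by
    rw [hy₀]; exact contDiffAt_chartFlow (hΘ a) (h0 a)
  have hF0 : ∀ a, F a (0, y₀) = y₀ := fun a ↦ by
    rw [hy₀]; exact (eventually_chartFlow_zero (h0 a)).self_of_nhds
  have hγ : HasFDerivAt γ (fderiv ℝ γ y₀) y₀ := by
    rw [hy₀]; exact (differentiableAt_chartMetric g x).hasFDerivAt
  have hkill : ∀ a v w, fderiv ℝ γ y₀ (ξ a) v w + γ y₀ (D a v) w + γ y₀ v (D a w) = 0 :=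
    fun a v w ↦ killing_equation hγ.differentiableAt (hF a)
      (by rw [hy₀]; exact eventually_chartFlow_zero (h0 a))
      (by rw [hy₀]; exact eventually_isometry_chartFlow (hΘ a) (h0 a) (hd a) (hiso a)) v w
  have hξ : ∀ v w, γ y₀ v w = ∑ a, γ y₀ v (ξ a) * γ y₀ w (ξ a) := fun v w ↦ by
    have hv : ∀ a, velocity (n := n) (fun t ↦ Θ a t x) =
        (mfderiv 𝓘(ℝ, EuclideanSpace ℝ (Fin n)) (𝓡 n) (extChartAt (𝓡 n) x).symm y₀ :
          EuclideanSpace ℝ (Fin n) →L[ℝ] EuclideanSpace ℝ (Fin n)) (ξ a) := fun a ↦ by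
      have h := (eventually_velocity_eq (hΘ a) (h0 a)).self_of_nhds
      rw [← hy₀, e] at h
      exact h
    have h1 : ∀ v w, γ y₀ v w = g.inner x
        ((mfderiv 𝓘(ℝ, EuclideanSpace ℝ (Fin n)) (𝓡 n) (extChartAt (𝓡 n) x).symm y₀ :
          EuclideanSpace ℝ (Fin n) →L[ℝ] EuclideanSpace ℝ (Fin n)) v)
        ((mfderiv 𝓘(ℝ, EuclideanSpace ℝ (Fin n)) (𝓡 n) (extChartAt (𝓡 n) x).symm y₀ :
          EuclideanSpace ℝ (Fin n) →L[ℝ] EuclideanSpace ℝ (Fin n)) w) := fun v w ↦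
      inner_congr_base g e rfl rfl
    simp only [h1, ← hv]
    exact hpars _ _
  have hpos : ∀ v, v ≠ 0 → 0 < γ y₀ v v := fun v hv ↦
    chartMetric_pos g x (by rw [hy₀]; exact mem_extChartAt_target x) hv
  -- first derivatives along the flows
  have hd1 : ∀ b, deriv (fun t ↦ f (Θ b t x)) 0 = fderiv ℝ u y₀ (ξ b) := fun b ↦ by
    have h := (eventually_deriv_flow_eq hf (hΘ b) (h0 b)).self_of_nhds
    rw [← hy₀, e, ← hu] at h
    exact h
  have hflow : ∀ b, HasDerivAt (fun t ↦ F b (t, y₀)) (ξ b) 0 := fun b ↦ hasDerivAt_flow (hF b)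
  have htime : ∀ b, ∀ᶠ t in 𝓝 (0 : ℝ), (extChartAt (𝓡 n) x).symm (F b (t, y₀)) = Θ b t x :=
    fun b ↦ by rw [hy₀]; exact eventually_symm_chartFlow_time (hΘ b) (h0 b)
  have hcont : ∀ b, Filter.Tendsto (fun t ↦ F b (t, y₀)) (𝓝 0) (𝓝 (extChartAt (𝓡 n) x x)) :=
    fun b ↦ by
      have := (hflow b).continuousAt.tendsto
      rw [← hy₀]
      rwa [hF0] at this
  have hvf : ∀ a, HasFDerivAt (velocityField (F a)) (D a) y₀ := fun a ↦
    hasFDerivAt_velocityField (hF a)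
  have hd2 : ∀ a, deriv (fun s ↦ deriv (fun t ↦ f (Θ a t (Θ a s x))) 0) 0 =
      fderiv ℝ (fderiv ℝ u) y₀ (ξ a) (ξ a) + fderiv ℝ u y₀ (D a (ξ a)) := fun a ↦ by
    have h1 : (fun s ↦ deriv (fun t ↦ f (Θ a t (Θ a s x))) 0) =ᶠ[𝓝 0]
        fun s ↦ fderiv ℝ u (F a (s, y₀)) (velocityField (F a) (F a (s, y₀))) := by
      filter_upwards [(hcont a).eventually (eventually_deriv_flow_eq hf (hΘ a) (h0 a)), htime a]
        with s hs hs'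
      rw [hs', ← hu] at hs
      exact hs
    rw [h1.deriv_eq]
    have h2 : HasFDerivAt (fderiv ℝ u) (fderiv ℝ (fderiv ℝ u) y₀) y₀ :=
      ((hu2.fderiv_right (m := 1) (by norm_num)).differentiableAt one_ne_zero).hasFDerivAt
    have h3 := (h2.clm_apply (hvf a)).comp_hasDerivAt_of_eq (f := fun s ↦ F a (s, y₀)) 0 (hflow a)
      (hF0 a).symm
    refine h3.deriv.trans ?_
    simp [add_comm]
    rfl
  have hd3 : ∀ a b, deriv (fun t ↦ speedSq g (fun s ↦ Θ a s (Θ b t x))) 0 =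
      fderiv ℝ γ y₀ (ξ b) (ξ a) (ξ a) + 2 * γ y₀ (D a (ξ b)) (ξ a) := fun a b ↦ by
    have h1 : (fun t ↦ speedSq g (fun s ↦ Θ a s (Θ b t x))) =ᶠ[𝓝 0]
        fun t ↦ γ (F b (t, y₀)) (velocityField (F a) (F b (t, y₀)))
          (velocityField (F a) (F b (t, y₀))) := by
      filter_upwards [(hcont b).eventually (eventually_speedSq_eq (g := g) (hΘ a) (h0 a)), htime b]
        with s hs hs'
      rw [hs'] at hs
      exact hs
    rw [h1.deriv_eq]
    have h3 := ((hγ.clm_apply (hvf a)).clm_apply (hvf a)).comp_hasDerivAt_of_eq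
      (f := fun s ↦ F b (s, y₀)) 0 (hflow b) (hF0 b).symm
    refine h3.deriv.trans ?_
    have hs : γ y₀ (velocityField (F a) y₀) (D a (ξ b)) = γ y₀ (D a (ξ b)) (ξ a) :=
      chartMetric_symm g x y₀ _ _
    simp [hs]
    change γ y₀ (D a (ξ b)) (ξ a) + (γ y₀ (D a (ξ b)) (ξ a) + fderiv ℝ γ y₀ (ξ b) (ξ a) (ξ a)) = _
    ring
  rw [laplacian_eq_sum_parseval g f x hy₀ hu hu2 ξ hξ]
  refine Finset.sum_congr rfl fun a _ ↦ ?_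
  have hdu : fderiv ℝ u y₀ (D a (ξ a)) = ∑ b, fderiv ℝ u y₀ (ξ b) * γ y₀ (D a (ξ a)) (ξ b) := by
    conv_lhs => rw [← sum_parseval_smul hpos hξ (D a (ξ a))]
    rw [map_sum]
    exact Finset.sum_congr rfl fun b _ ↦ by rw [map_smul, smul_eq_mul, mul_comm]
  rw [hd2, hdu, add_assoc, ← Finset.sum_add_distrib, sub_eq_add_neg, ← Finset.sum_neg_distrib]
  congr 1
  refine Finset.sum_congr rfl fun b _ ↦ ?_
  rw [hd3, hd1]
  have h1 := hkill a (ξ a) (ξ b)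
  have h2 : γ y₀ (ξ a) (D a (ξ b)) = γ y₀ (D a (ξ b)) (ξ a) := chartMetric_symm g x y₀ _ _
  change -(fderiv ℝ u y₀ (ξ b) * (fderiv ℝ γ y₀ (ξ a) (ξ a) (ξ b)
    - (1 / 2 : ℝ) * fderiv ℝ γ y₀ (ξ b) (ξ a) (ξ a))) = _
  linear_combination (-fderiv ℝ u y₀ (ξ b)) * h1 + (fderiv ℝ u y₀ (ξ b)) * h2

end Flow

/-! ### Submersions and the smooth action on a homogeneous space -/

section Submersion

variable {d e : ℕ} {M N : Type*} [TopologicalSpace M] [ChartedSpace (EuclideanSpace ℝ (Fin d)) M]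
  [TopologicalSpace N] [ChartedSpace (EuclideanSpace ℝ (Fin e)) N]

/-- A submersion has smooth local sections through every point of its source. -/
theorem exists_local_section {q : M → N} {a : M} (hq : IsSubmersionAt (𝓡 d) (𝓡 e) ∞ q a) :
    ∃ s : N → M, ContMDiffAt (𝓡 e) (𝓡 d) ∞ s (q a) ∧ s (q a) = a ∧
      ∀ᶠ y in 𝓝 (q a), q (s y) = y := by
  have hw := hq.writtenInCharts
  have hs := hq.source_subset_preimage_source
  have hdom := hq.domChart_mem_maximalAtlas
  have hcod := hq.codChart_mem_maximalAtlas
  have ha := hq.mem_domChart_source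
  have hqa := hq.mem_codChart_source
  set φ := hq.domChart
  set χ := hq.codChart
  set A := hq.equiv
  have hw' : ∀ z ∈ φ.target, χ (q (φ.symm z)) = (A z).1 := fun z hz ↦ by
    have := hw (x := z) (by simpa using hz)
    simpa using this
  let c := (A (φ a)).2
  let σ : N → EuclideanSpace ℝ (Fin d) := fun y ↦ A.symm (χ y, c)
  -- in the charts `q` is a projection, and the section keeps the complementary coordinate of `a`
  have hσa : σ (q a) = φ a := by
    have h1 := hw' (φ a) (φ.map_source ha)
    rw [φ.left_inv ha] at h1
    change A.symm (χ (q a), (A (φ a)).2) = φ a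
    rw [h1]
    exact A.symm_apply_apply _
  have hσ : ContMDiffAt (𝓡 e) 𝓘(ℝ, EuclideanSpace ℝ (Fin d)) ∞ σ (q a) := by
    have h1 : ContMDiffAt (𝓡 e) 𝓘(ℝ, EuclideanSpace ℝ (Fin e)) ∞ χ (q a) :=
      (contMDiffOn_of_mem_maximalAtlas hcod).contMDiffAt (χ.open_source.mem_nhds hqa)
    have h2 : ContDiff ℝ ∞ (fun z : EuclideanSpace ℝ (Fin e) ↦ A.symm (z, c)) := by fun_prop
    exact h2.contMDiff.contMDiffAt.comp (q a) h1
  have hmem : ∀ᶠ y in 𝓝 (q a), σ y ∈ φ.target :=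
    hσ.continuousAt.eventually_mem (by
      rw [hσa]; exact φ.open_target.mem_nhds (φ.map_source ha))
  refine ⟨fun y ↦ φ.symm (σ y), ?_, ?_, ?_⟩
  · have h1 : ContMDiffAt 𝓘(ℝ, EuclideanSpace ℝ (Fin d)) (𝓡 d) ∞ φ.symm (σ (q a)) := by
      rw [hσa]
      exact (contMDiffOn_symm_of_mem_maximalAtlas hdom).contMDiffAt
        (φ.open_target.mem_nhds (φ.map_source ha))
    exact h1.comp (q a) hσ
  · change φ.symm (σ (q a)) = a
    rw [hσa, φ.left_inv ha]
  · filter_upwards [hmem, χ.open_source.mem_nhds hqa] with y hy hy'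
    refine χ.injOn (hs (φ.map_target hy)) hy' ?_
    rw [hw' _ hy]
    simp [σ]

end Submersion

section Action

variable {d e : ℕ} {G : Type*} [TopologicalSpace G] [ChartedSpace (EuclideanSpace ℝ (Fin d)) G]
  [Group G] {L : Subgroup G} [ChartedSpace (EuclideanSpace ℝ (Fin e)) (G ⧸ L)]

theorem IsQuotientManifold.exists_section (hL : IsQuotientManifold (d := d) (e := e) L) (a : G) :
    ∃ s : G ⧸ L → G, ContMDiffAt (𝓡 e) (𝓡 d) ∞ s (a : G ⧸ L) ∧ s (a : G ⧸ L) = a ∧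
      ∀ᶠ y in 𝓝 (a : G ⧸ L), (s y : G ⧸ L) = y :=
  exists_local_section (IsSubmersion.isSubmersionAt hL a)

theorem IsQuotientManifold.contMDiff_mk [IsManifold (𝓡 e) ∞ (G ⧸ L)]
    (hL : IsQuotientManifold (d := d) (e := e) L) :
    ContMDiff (𝓡 d) (𝓡 e) ∞ (fun a : G ↦ (a : G ⧸ L)) :=
  IsSubmersion.contMDiff hL

/-- A map on `G ⧸ L` is smooth at a point if its lift to `G` is. -/
theorem IsQuotientManifold.contMDiffAt_of_comp_mk (hL : IsQuotientManifold (d := d) (e := e) L)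
    {E' : Type*} [NormedAddCommGroup E'] [NormedSpace ℝ E'] {H' : Type*} [TopologicalSpace H']
    {I' : ModelWithCorners ℝ E' H'} {N : Type*} [TopologicalSpace N] [ChartedSpace H' N]
    {r : WithTop ℕ∞} (hr : r ≤ ∞) {f : G ⧸ L → N} {a : G}
    (hf : ContMDiffAt (𝓡 d) I' r (fun b : G ↦ f (b : G ⧸ L)) a) :
    ContMDiffAt (𝓡 e) I' r f (a : G ⧸ L) := by
  obtain ⟨s, hs, hsa, hsec⟩ := hL.exists_section a
  refine (ContMDiffAt.comp_of_eq hf (hs.of_le hr) hsa).congr_of_eventuallyEq ?_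
  filter_upwards [hsec] with y hy
  exact congrArg f hy.symm

/-- The derivative of the projection `G → G ⧸ L` at the identity is onto. -/
theorem IsQuotientManifold.dproj_surjective [IsManifold (𝓡 e) ∞ (G ⧸ L)]
    (hL : IsQuotientManifold (d := d) (e := e) L) (u : EuclideanSpace ℝ (Fin e)) :
    ∃ U : GroupLieAlgebra (𝓡 d) G, (dproj L U : EuclideanSpace ℝ (Fin e)) = u := by
  obtain ⟨s, hs, hsa, hsec⟩ := hL.exists_section 1
  have h1 := mfderiv_comp_of_eq (x := ((1 : G) : G ⧸ L)) (f := s) (g := fun a : G ↦ (a : G ⧸ L))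
    (hL.contMDiff_mk.mdifferentiable (by simp) 1) (hs.mdifferentiableAt (by simp)) hsa
  have h2 : ((fun a : G ↦ (a : G ⧸ L)) ∘ s) =ᶠ[𝓝 ((1 : G) : G ⧸ L)] id := hsec
  have h3 := h2.mfderiv_eq (I := 𝓡 e) (I' := 𝓡 e)
  rw [mfderiv_id] at h3
  refine ⟨(mfderiv (𝓡 e) (𝓡 d) s ((1 : G) : G ⧸ L) :
    EuclideanSpace ℝ (Fin e) →L[ℝ] EuclideanSpace ℝ (Fin d)) u, ?_⟩
  have h4 := congrArg (fun A : EuclideanSpace ℝ (Fin e) →L[ℝ] EuclideanSpace ℝ (Fin e) ↦ A u)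
    (h1.symm.trans h3)
  refine Eq.trans ?_ h4
  exact congrArg (fun A : EuclideanSpace ℝ (Fin d) →L[ℝ] EuclideanSpace ℝ (Fin e) ↦ A
    ((mfderiv (𝓡 e) (𝓡 d) s ((1 : G) : G ⧸ L) :
      EuclideanSpace ℝ (Fin e) →L[ℝ] EuclideanSpace ℝ (Fin d)) u))
    (mfderiv_congr_point (f := fun a : G ↦ (a : G ⧸ L)) hsa).symm

variable [LieGroup (𝓡 d) ∞ G]

/-- The action of `G` on `G ⧸ L` is smooth. -/
theorem IsQuotientManifold.contMDiff_smul [IsManifold (𝓡 e) ∞ (G ⧸ L)]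
    (hL : IsQuotientManifold (d := d) (e := e) L) :
    ContMDiff ((𝓡 d).prod (𝓡 e)) (𝓡 e) ∞ (fun z : G × G ⧸ L ↦ z.1 • z.2) := by
  rintro ⟨b, y⟩
  induction y using QuotientGroup.induction_on with | _ a =>
  obtain ⟨s, hs, hsa, hsec⟩ := hL.exists_section a
  have h1 : ContMDiffAt ((𝓡 d).prod (𝓡 e)) (𝓡 d) ∞ (fun z : G × G ⧸ L ↦ z.1 * s z.2)
      (b, (a : G ⧸ L)) :=
    ContMDiffAt.mul contMDiffAt_fst
      (ContMDiffAt.comp (g := s) (f := Prod.snd) (b, (a : G ⧸ L)) hs contMDiffAt_snd)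
  refine (ContMDiffAt.comp (b, (a : G ⧸ L)) hL.contMDiff_mk.contMDiffAt h1).congr_of_eventuallyEq ?_
  filter_upwards [continuousAt_snd.eventually hsec] with z hz
  change z.1 • z.2 = z.1 • ((s z.2 : G) : G ⧸ L)
  rw [hz]

theorem IsQuotientManifold.mdifferentiable_smul [IsManifold (𝓡 e) ∞ (G ⧸ L)]
    (hL : IsQuotientManifold (d := d) (e := e) L) (b : G) :
    MDifferentiable (𝓡 e) (𝓡 e) (fun y : G ⧸ L ↦ b • y) := by
  have h : ContMDiff (𝓡 e) (𝓡 e) ∞ (fun y : G ⧸ L ↦ b • y) :=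
    hL.contMDiff_smul.comp (contMDiff_const.prodMk contMDiff_id)
  exact h.mdifferentiable (by simp)

end Action

/-! ### Curves in a Lie group and the adjoint representation -/

section LieCurves

variable {d : ℕ} {G : Type*} [TopologicalSpace G] [ChartedSpace (EuclideanSpace ℝ (Fin d)) G]

/-- The velocity of a curve through `p`, computed in the chart at `p`. -/
theorem hasDerivAt_extChartAt_comp {c : ℝ → G} {p : G} (hp : c 0 = p)
    (hc : MDifferentiableAt 𝓘(ℝ, ℝ) (𝓡 d) c 0) :
    HasDerivAt (fun t ↦ extChartAt (𝓡 d) p (c t)) (velocity c) 0 := by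
  subst hp
  have h := hc.hasMFDerivAt.2
  simp only [writtenInExtChartAt, mfld_simps] at h
  let A : ℝ →L[ℝ] EuclideanSpace ℝ (Fin d) := mfderiv 𝓘(ℝ, ℝ) (𝓡 d) c 0
  have h' : HasFDerivWithinAt (fun t ↦ extChartAt (𝓡 d) (c 0) (c t)) A univ (0 : ℝ) := by
    simp only [mfld_simps]
    exact h
  exact (hasFDerivWithinAt_univ.1 h').hasDerivAt

theorem mfderiv_apply_of_eq_id {f : G → G} (hf : f = id) (p : G) (v : EuclideanSpace ℝ (Fin d)) :
    (mfderiv (𝓡 d) (𝓡 d) f p : EuclideanSpace ℝ (Fin d) →L[ℝ] EuclideanSpace ℝ (Fin d)) v = v := by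
  subst hf
  rw [mfderiv_id]
  rfl

theorem velocity_const (p : G) : velocity (n := d) (fun _ : ℝ ↦ p) = 0 := by
  rw [velocity, mfderiv_const]; rfl

variable [Group G] [LieGroup (𝓡 d) ∞ G]

theorem velocity_mul {γ δ : ℝ → G} (hγ : MDifferentiableAt 𝓘(ℝ, ℝ) (𝓡 d) γ 0)
    (hδ : MDifferentiableAt 𝓘(ℝ, ℝ) (𝓡 d) δ 0) (hγ0 : γ 0 = 1) (hδ0 : δ 0 = 1) :
    velocity (n := d) (fun t ↦ γ t * δ t) = velocity γ + velocity δ := by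
  have hF : MDifferentiableAt ((𝓡 d).prod (𝓡 d)) (𝓡 d) (fun z : G × G ↦ z.1 * z.2) (γ 0, δ 0) :=
    (contMDiff_mul (𝓡 d) ∞).mdifferentiable (by simp) _
  have hd := hγ.hasMFDerivAt.prodMk hδ.hasMFDerivAt
  have h1 := (HasMFDerivAt.comp (0 : ℝ) (g := fun z : G × G ↦ z.1 * z.2) hF.hasMFDerivAt hd).mfderiv
  have h2 := mfderiv_prod_eq_add_apply (v := ((velocity γ, velocity δ) :
    EuclideanSpace ℝ (Fin d) × EuclideanSpace ℝ (Fin d))) hF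
  refine Eq.trans (congrArg (fun A : ℝ →L[ℝ] EuclideanSpace ℝ (Fin d) ↦ A 1) h1) ?_
  refine Eq.trans h2 ?_
  refine congrArg₂ (fun u v : EuclideanSpace ℝ (Fin d) ↦ u + v) ?_ ?_
  · have e : (fun z : G ↦ z * δ 0) = id := by funext z; simp [hδ0]
    exact mfderiv_apply_of_eq_id e _ _
  · have e : (fun z : G ↦ γ 0 * z) = id := by funext z; simp [hγ0]
    exact mfderiv_apply_of_eq_id e _ _

theorem velocity_inv {γ : ℝ → G} (hγ : MDifferentiableAt 𝓘(ℝ, ℝ) (𝓡 d) γ 0) (hγ0 : γ 0 = 1) :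
    velocity (n := d) (fun t ↦ (γ t)⁻¹) = -velocity γ := by
  have hi : MDifferentiableAt 𝓘(ℝ, ℝ) (𝓡 d) (fun t ↦ (γ t)⁻¹) 0 :=
    MDifferentiableAt.comp (0 : ℝ) (g := fun z : G ↦ z⁻¹)
      ((contMDiff_inv (𝓡 d) ∞).mdifferentiable (by simp) _) hγ
  have h := velocity_mul hγ hi hγ0 (by simp [hγ0])
  simp only [mul_inv_cancel, velocity_const] at h
  exact (neg_eq_of_add_eq_zero_right h.symm).symm

theorem contMDiff_conj (a : G) : ContMDiff (𝓡 d) (𝓡 d) ∞ (fun x : G ↦ a * x * a⁻¹) :=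
  (contMDiff_const.mul contMDiff_id).mul contMDiff_const

theorem velocity_conj (a : G) {γ : ℝ → G} (hγ : MDifferentiableAt 𝓘(ℝ, ℝ) (𝓡 d) γ 0)
    (hγ0 : γ 0 = 1) :
    velocity (n := d) (fun t ↦ a * γ t * a⁻¹) = Ad (d := d) a (velocity γ) := by
  rw [velocity_comp (q := fun x : G ↦ a * x * a⁻¹)
    ((contMDiff_conj a).mdifferentiable (by simp) _) hγ]
  exact congrArg (fun A : EuclideanSpace ℝ (Fin d) →L[ℝ] EuclideanSpace ℝ (Fin d) ↦
    A (velocity γ)) (mfderiv_congr_point (f := fun x : G ↦ a * x * a⁻¹) hγ0)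

/-- Every element of the Lie algebra is the velocity of a curve in `G`. -/
theorem exists_isCurveIn_top (X : GroupLieAlgebra (𝓡 d) G) :
    ∃ γ : ℝ → G, IsCurveIn (⊤ : Subgroup G) X γ := by
  set φ := extChartAt (𝓡 d) (1 : G) with hφ
  let v : EuclideanSpace ℝ (Fin d) := X
  let ℓ : ℝ → EuclideanSpace ℝ (Fin d) := fun t ↦ φ 1 + t • v
  have hℓ : ContDiff ℝ ∞ ℓ := by fun_prop
  have hℓ0 : ℓ 0 = φ 1 := by simp [ℓ]
  have h0 : φ.symm (ℓ 0) = 1 := by rw [hℓ0]; exact extChartAt_to_inv (1 : G)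
  have hs : ContMDiffAt 𝓘(ℝ, ℝ) (𝓡 d) ∞ (fun t ↦ φ.symm (ℓ t)) 0 := by
    have h1 : ContMDiffAt 𝓘(ℝ, EuclideanSpace ℝ (Fin d)) (𝓡 d) ∞ φ.symm (φ 1) :=
      (contMDiffOn_extChartAt_symm (1 : G)).contMDiffAt (extChartAt_target_mem_nhds (1 : G))
    exact ContMDiffAt.comp_of_eq h1 hℓ.contMDiff.contMDiffAt hℓ0
  refine ⟨fun t ↦ φ.symm (ℓ t), h0, fun _ ↦ Subgroup.mem_top _, hs, ?_⟩
  have h1 := hasDerivAt_extChartAt_comp h0 (hs.mdifferentiableAt (by simp))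
  have h2 : HasDerivAt ℓ ((1 : ℝ) • v) 0 :=
    ((hasDerivAt_id (0 : ℝ)).smul_const _).const_add _
  rw [one_smul] at h2
  refine h1.unique (h2.congr_of_eventuallyEq ?_)
  have hmem : ∀ᶠ t in 𝓝 (0 : ℝ), ℓ t ∈ φ.target :=
    hℓ.continuous.continuousAt.eventually_mem (by
      rw [hℓ0]; exact extChartAt_target_mem_nhds (1 : G))
  filter_upwards [hmem] with t ht
  exact φ.right_inv ht

/-- The mixed partial derivatives of a map of two real variables, taken in either order. -/
theorem exists_hasDerivAt_mixed {E : Type*} [NormedAddCommGroup E] [NormedSpace ℝ E]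
    {Q : ℝ × ℝ → E} (hQ : ContDiffAt ℝ 2 Q (0, 0)) :
    ∃ W, HasDerivAt (fun t ↦ deriv (fun s ↦ Q (t, s)) 0) W 0 ∧
      HasDerivAt (fun s ↦ deriv (fun t ↦ Q (t, s)) 0) W 0 := by
  refine ⟨velocityFieldDeriv Q 0 1, ?_, ?_⟩
  · exact hasDerivAt_fderiv_flow hQ 1
  · have hc : ContinuousAt (fun s : ℝ ↦ ((0 : ℝ), s)) 0 := by fun_prop
    refine (hasFDerivAt_velocityField hQ).hasDerivAt.congr_of_eventuallyEq ?_
    filter_upwards [hc.eventually (hQ.eventually (by simp))] with s hs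
    exact (hasDerivAt_flow hs).deriv

/-- For curves `γ`, `δ` through the identity with velocities `Z`, `X`, the derivatives at `0` of
`Ad (γ t)⁻¹ X` and of `Ad (δ s) Z` agree (both are `-[Z, X] = [X, Z]`): they are the mixed second
derivatives of the commutator `(γ t)⁻¹ (δ s) (γ t) (δ s)⁻¹`. -/
theorem exists_hasDerivAt_Ad {γ δ : ℝ → G} {Z X : GroupLieAlgebra (𝓡 d) G}
    {L₁ L₂ : Subgroup G} (hγ : IsCurveIn L₁ Z γ) (hδ : IsCurveIn L₂ X δ) :
    ∃ W : EuclideanSpace ℝ (Fin d),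
      HasDerivAt (F := EuclideanSpace ℝ (Fin d)) (fun t ↦ Ad (d := d) (γ t)⁻¹ X) W 0 ∧
      HasDerivAt (F := EuclideanSpace ℝ (Fin d)) (fun s ↦ Ad (d := d) (δ s) Z) W 0 := by
  have hγd := hγ.smooth.mdifferentiableAt (by simp)
  have hδd := hδ.smooth.mdifferentiableAt (by simp)
  have hγv : velocity γ = Z := hγ.velocity
  have hδv : velocity δ = X := hδ.velocity
  have hconj : ∀ (a : G) {c : ℝ → G}, MDifferentiableAt 𝓘(ℝ, ℝ) (𝓡 d) c 0 →
      MDifferentiableAt 𝓘(ℝ, ℝ) (𝓡 d) (fun t ↦ a * c t * a⁻¹) 0 := fun a c hc ↦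
    MDifferentiableAt.comp (0 : ℝ) (g := fun x : G ↦ a * x * a⁻¹)
      ((contMDiff_conj a).mdifferentiable (by simp) _) hc
  have hinv : ∀ {c : ℝ → G}, MDifferentiableAt 𝓘(ℝ, ℝ) (𝓡 d) c 0 →
      MDifferentiableAt 𝓘(ℝ, ℝ) (𝓡 d) (fun t ↦ (c t)⁻¹) 0 := fun hc ↦
    MDifferentiableAt.comp (0 : ℝ) (g := fun z : G ↦ z⁻¹)
      ((contMDiff_inv (𝓡 d) ∞).mdifferentiable (by simp) _) hc
  have hmul : ∀ {c c' : ℝ → G}, MDifferentiableAt 𝓘(ℝ, ℝ) (𝓡 d) c 0 →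
      MDifferentiableAt 𝓘(ℝ, ℝ) (𝓡 d) c' 0 →
      MDifferentiableAt 𝓘(ℝ, ℝ) (𝓡 d) (fun t ↦ c t * c' t) 0 := fun hc hc' ↦
    MDifferentiableAt.comp (0 : ℝ) (g := fun z : G × G ↦ z.1 * z.2)
      ((contMDiff_mul (𝓡 d) ∞).mdifferentiable (by simp) _) (hc.prodMk hc')
  let Q : ℝ × ℝ → EuclideanSpace ℝ (Fin d) := fun z ↦
    extChartAt (𝓡 d) (1 : G) ((γ z.1)⁻¹ * δ z.2 * γ z.1 * (δ z.2)⁻¹)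
  have hQ : ContDiffAt ℝ 2 Q (0, 0) := by
    have h1 : ContMDiffAt (𝓘(ℝ, ℝ).prod 𝓘(ℝ, ℝ)) (𝓡 d) ∞ (fun z : ℝ × ℝ ↦ γ z.1)
        ((0 : ℝ), (0 : ℝ)) :=
      ContMDiffAt.comp (x := ((0 : ℝ), (0 : ℝ))) (g := γ) (f := Prod.fst) hγ.smooth contMDiffAt_fst
    have h2 : ContMDiffAt (𝓘(ℝ, ℝ).prod 𝓘(ℝ, ℝ)) (𝓡 d) ∞ (fun z : ℝ × ℝ ↦ δ z.2)
        ((0 : ℝ), (0 : ℝ)) :=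
      ContMDiffAt.comp (x := ((0 : ℝ), (0 : ℝ))) (g := δ) (f := Prod.snd) hδ.smooth contMDiffAt_snd
    have h3 := ((h1.inv.mul h2).mul h1).mul h2.inv
    have h4 : ContMDiffAt (𝓡 d) 𝓘(ℝ, EuclideanSpace ℝ (Fin d)) ∞ (extChartAt (𝓡 d) (1 : G)) 1 :=
      contMDiffAt_extChartAt
    have h5 := ContMDiffAt.comp_of_eq h4 h3 (by simp [hγ.zero, hδ.zero])
    rw [← modelWithCornersSelf_prod, chartedSpaceSelf_prod] at h5
    exact h5.contDiffAt.of_le ENat.LEInfty.out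
  obtain ⟨W, hW1, hW2⟩ := exists_hasDerivAt_mixed hQ
  have e1 : ∀ t, deriv (fun s ↦ Q (t, s)) 0 = Ad (d := d) (γ t)⁻¹ X - X := fun t ↦ by
    have hc := hconj (γ t)⁻¹ hδd
    have hv := velocity_mul hc (hinv hδd) (by simp [hδ.zero]) (by simp [hδ.zero])
    rw [velocity_conj _ hδd hδ.zero, velocity_inv hδd hδ.zero, hδv] at hv
    have h := hasDerivAt_extChartAt_comp (p := 1) (by simp [hδ.zero]) (hmul hc (hinv hδd))
    rw [hv] at h
    simp only [inv_inv] at h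
    exact h.deriv.trans (sub_eq_add_neg _ _).symm
  have e2 : ∀ s, deriv (fun t ↦ Q (t, s)) 0 = Ad (d := d) (δ s) Z - Z := fun s ↦ by
    have hc := hconj (δ s) hγd
    have hv := velocity_mul (hinv hγd) hc (by simp [hγ.zero]) (by simp [hγ.zero])
    rw [velocity_conj _ hγd hγ.zero, velocity_inv hγd hγ.zero, hγv] at hv
    have h := hasDerivAt_extChartAt_comp (p := 1) (by simp [hγ.zero]) (hmul (hinv hγd) hc)
    rw [hv] at h
    simp only [← mul_assoc] at h
    exact h.deriv.trans ((add_comm _ _).trans (sub_eq_add_neg _ _).symm)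
  let x : EuclideanSpace ℝ (Fin d) := X
  let z : EuclideanSpace ℝ (Fin d) := Z
  refine ⟨W, ?_, ?_⟩
  · refine (hW1.add_const x).congr_of_eventuallyEq
      (Filter.Eventually.of_forall fun t ↦ ?_)
    exact ((congrArg (fun v : EuclideanSpace ℝ (Fin d) ↦ v + x) (e1 t)).trans
      (sub_add_cancel (G := EuclideanSpace ℝ (Fin d)) _ _)).symm
  · refine (hW2.add_const z).congr_of_eventuallyEq
      (Filter.Eventually.of_forall fun t ↦ ?_)
    exact ((congrArg (fun v : EuclideanSpace ℝ (Fin d) ↦ v + z) (e2 t)).trans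
      (sub_add_cancel (G := EuclideanSpace ℝ (Fin d)) _ _)).symm

end LieCurves

/-! ### The Laplacian of an invariant metric on a homogeneous space -/

section LinearAlgebra

/-- A scalar product on a finite-dimensional space has a finite family satisfying Parseval's
identity, namely an orthonormal basis. -/
theorem exists_parseval_family {V : Type*} [AddCommGroup V] [Module ℝ V] [FiniteDimensional ℝ V]
    (B : V →ₗ[ℝ] V →ₗ[ℝ] ℝ) (hsymm : ∀ X Y, B X Y = B Y X) (hpos : ∀ X, X ≠ 0 → 0 < B X X) :
    ∃ (r : ℕ) (v : Fin r → V), ∀ U W, B U W = ∑ i, B U (v i) * B W (v i) := by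
  let core : InnerProductSpace.Core ℝ V :=
    { inner := fun X Y ↦ B X Y
      conj_inner_symm := fun X Y ↦ hsymm Y X
      re_inner_nonneg := fun X ↦ by
        rcases eq_or_ne X 0 with rfl | hX
        · simp
        · exact (hpos X hX).le
      add_left := fun X Y Z ↦ by simp
      smul_left := fun X Y r ↦ by simp
      definite := fun X hX ↦ by
        by_contra hne
        exact (hpos X hne).ne' hX }
  let : NormedAddCommGroup V := core.toNormedAddCommGroup
  let : InnerProductSpace ℝ V := InnerProductSpace.ofCore core.toCore
  refine ⟨_, stdOrthonormalBasis ℝ V, fun U W ↦ ?_⟩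
  have h := (stdOrthonormalBasis ℝ V).sum_inner_mul_inner U W
  refine h.symm.trans (Finset.sum_congr rfl fun i _ ↦ ?_)
  exact congrArg (B U (stdOrthonormalBasis ℝ V i) * ·) (hsymm _ _)

theorem hasDerivAt_bilin_self {E : Type*} [NormedAddCommGroup E] [NormedSpace ℝ E]
    [FiniteDimensional ℝ E] (B : E →ₗ[ℝ] E →ₗ[ℝ] ℝ) {c : ℝ → E} {W : E} (hc : HasDerivAt c W 0) :
    HasDerivAt (fun t ↦ B (c t) (c t)) (B W (c 0) + B (c 0) W) 0 := by
  have h1 := B.toContinuousBilinearMap.hasFDerivAt.comp_hasDerivAt (0 : ℝ) hc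
  exact h1.clm_apply hc

end LinearAlgebra

section Homogeneous

variable {d e : ℕ} {G : Type*} [TopologicalSpace G] [ChartedSpace (EuclideanSpace ℝ (Fin d)) G]
  [Group G] {L : Subgroup G} [ChartedSpace (EuclideanSpace ℝ (Fin e)) (G ⧸ L)]

theorem dproj_add (X Y : GroupLieAlgebra (𝓡 d) G) :
    dproj (e := e) L (X + Y) = dproj L X + dproj L Y := map_add _ _ _

variable [IsManifold (𝓡 e) ∞ (G ⧸ L)]

/-- Left translations act on tangent spaces by isomorphisms, so that with the projection at the
identity every tangent space is a quotient of the Lie algebra. -/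
theorem exists_mfderiv_smul_dproj_eq (hL : IsQuotientManifold (d := d) (e := e) L)
    {g : RiemMetric e (G ⧸ L)} (hg : IsInvariantMetric g) (a : G) (u : EuclideanSpace ℝ (Fin e)) :
    ∃ U : GroupLieAlgebra (𝓡 d) G,
      (mfderiv (𝓡 e) (𝓡 e) (fun y : G ⧸ L ↦ a • y) ((1 : G) : G ⧸ L) :
        EuclideanSpace ℝ (Fin e) →L[ℝ] EuclideanSpace ℝ (Fin e)) (dproj L U) = u := by
  let A : EuclideanSpace ℝ (Fin e) →L[ℝ] EuclideanSpace ℝ (Fin e) :=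
    mfderiv (𝓡 e) (𝓡 e) (fun y : G ⧸ L ↦ a • y) ((1 : G) : G ⧸ L)
  have hinj : Function.Injective A := by
    refine (injective_iff_map_eq_zero A).2 fun v hv ↦ ?_
    by_contra hne
    have h1 := hg a ((1 : G) : G ⧸ L) v v
    have h2 := g.pos ((1 : G) : G ⧸ L) v hne
    rw [← h1] at h2
    refine absurd h2 (not_lt.2 (le_of_eq ?_))
    exact (inner_congr_base g rfl hv hv).trans
      (map_zero (g.inner (a • ((1 : G) : G ⧸ L)) 0))
  obtain ⟨v, hv⟩ := (LinearMap.injective_iff_surjective (f := A.toLinearMap)).1 hinj u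
  obtain ⟨U, hU⟩ := hL.dproj_surjective v
  exact ⟨U, (congrArg A hU).trans hv⟩

variable [LieGroup (𝓡 d) ∞ G]

/-- The velocity of the orbit `b δ(t) L` of a curve `δ` through the identity. -/
theorem velocity_smul_mk (hL : IsQuotientManifold (d := d) (e := e) L) (b : G) {δ : ℝ → G}
    (hδ : MDifferentiableAt 𝓘(ℝ, ℝ) (𝓡 d) δ 0) (hδ0 : δ 0 = 1) :
    velocity (n := e) (fun t ↦ b • (δ t : G ⧸ L)) =
      (mfderiv (𝓡 e) (𝓡 e) (fun y : G ⧸ L ↦ b • y) ((1 : G) : G ⧸ L) :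
        EuclideanSpace ℝ (Fin e) →L[ℝ] EuclideanSpace ℝ (Fin e)) (dproj (d := d) L (velocity (n := d) δ)) := by
  have hq : MDifferentiableAt (𝓡 d) (𝓡 e) (fun a : G ↦ (a : G ⧸ L)) (δ 0) :=
    hL.contMDiff_mk.mdifferentiable (by simp) _
  rw [velocity_comp (q := fun y : G ⧸ L ↦ b • y) (c := fun t ↦ (δ t : G ⧸ L))
    (hL.mdifferentiable_smul b _) (MDifferentiableAt.comp (0 : ℝ) hq hδ),
    velocity_comp (q := fun a : G ↦ (a : G ⧸ L)) hq hδ]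
  have e1 := mfderiv_congr_point (I := 𝓡 d) (I' := 𝓡 e) (f := fun a : G ↦ (a : G ⧸ L)) hδ0
  have e2 := mfderiv_congr_point (I := 𝓡 e) (I' := 𝓡 e) (f := fun y : G ⧸ L ↦ b • y)
    (congrArg (fun a : G ↦ (a : G ⧸ L)) hδ0)
  refine congrArg₂ (fun (A : EuclideanSpace ℝ (Fin e) →L[ℝ] EuclideanSpace ℝ (Fin e))
    (v : EuclideanSpace ℝ (Fin e)) ↦ A v) e2 ?_
  exact congrArg (fun A : EuclideanSpace ℝ (Fin d) →L[ℝ] EuclideanSpace ℝ (Fin e) ↦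
    A (velocity δ)) e1

/-- For an invariant metric, the speed of `b δ(t) L` does not depend on `b`. -/
theorem speedSq_smul_mk (hL : IsQuotientManifold (d := d) (e := e) L) {g : RiemMetric e (G ⧸ L)}
    (hg : IsInvariantMetric g) (b : G) {δ : ℝ → G}
    (hδ : MDifferentiableAt 𝓘(ℝ, ℝ) (𝓡 d) δ 0) (hδ0 : δ 0 = 1) :
    speedSq g (fun t ↦ b • (δ t : G ⧸ L)) =
      g.inner ((1 : G) : G ⧸ L) (dproj (d := d) L (velocity (n := d) δ)) (dproj (d := d) L (velocity (n := d) δ)) := by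
  have hv := velocity_smul_mk hL b hδ hδ0
  exact (inner_congr_base g (congrArg (fun a : G ↦ b • (a : G ⧸ L)) hδ0) hv hv).trans
    (hg b _ _ _)

/-- The derivative of the projection kills the Lie algebra of the subgroup. -/
theorem dproj_eq_zero (hL : IsQuotientManifold (d := d) (e := e) L) {X : GroupLieAlgebra (𝓡 d) G}
    (hX : X ∈ lieAlgebraOf L) : dproj (e := e) L X = 0 := by
  obtain ⟨γ, hγ⟩ := hX
  have hd := hγ.smooth.mdifferentiableAt (by simp)
  have hq : MDifferentiableAt (𝓡 d) (𝓡 e) (fun a : G ↦ (a : G ⧸ L)) (γ 0) :=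
    hL.contMDiff_mk.mdifferentiable (by simp) _
  have h := velocity_comp (q := fun a : G ↦ (a : G ⧸ L)) hq hd
  have hconst : (fun t ↦ (γ t : G ⧸ L)) = fun _ ↦ ((1 : G) : G ⧸ L) := by
    funext t
    rw [QuotientGroup.eq]
    simpa using hγ.mem t
  rw [hconst, velocity_const] at h
  have hv : velocity γ = X := hγ.velocity
  rw [hv] at h
  refine Eq.trans ?_ h.symm
  exact congrArg (fun A : EuclideanSpace ℝ (Fin d) →L[ℝ] EuclideanSpace ℝ (Fin e) ↦ A X)
    (mfderiv_congr_point (f := fun a : G ↦ (a : G ⧸ L)) hγ.zero).symm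

/-- The Laplacian of an invariant metric on `G ⧸ L` at `a L`, in terms of a family `X` in the Lie
algebra satisfying Parseval's identity for the scalar product pulled back from the tangent space
at the base point: `Δ f = ∑_i (X_i X_i f + ½ ∑_j d/dt |Ad (exp (-t X_j)) X_i|² X_j f)`, where the
vector fields are those of the left action of `G`, conjugated by `a`. Any curves `γ_i` with
velocities `X_i` replace the one-parameter groups. -/
theorem laplacian_eq_sum_Ad (hL : IsQuotientManifold (d := d) (e := e) L)
    {g : RiemMetric e (G ⧸ L)} (hg : IsInvariantMetric g) {ι : Type*} [Fintype ι]
    {X : ι → GroupLieAlgebra (𝓡 d) G} {S : ι → Subgroup G} {γ : ι → ℝ → G}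
    (hγ : ∀ i, IsCurveIn (S i) (X i) (γ i))
    {β : GroupLieAlgebra (𝓡 d) G → GroupLieAlgebra (𝓡 d) G → ℝ}
    (hβ : ∀ U V, g.inner ((1 : G) : G ⧸ L) (dproj L U) (dproj L V) = β U V)
    (hpars : ∀ U V, β U V = ∑ i, β U (X i) * β V (X i)) (a : G) {f : G ⧸ L → ℝ}
    (hf : ContMDiffAt (𝓡 e) 𝓘(ℝ, ℝ) 2 f (a • ((1 : G) : G ⧸ L))) :
    laplacian g f (a • ((1 : G) : G ⧸ L)) = ∑ i,
      (deriv (fun s ↦ deriv (fun t ↦ f ((a * γ i t * a⁻¹) •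
        (a * γ i s * a⁻¹) • a • ((1 : G) : G ⧸ L))) 0) 0 +
      ∑ j, (1 / 2 : ℝ) * deriv (fun t ↦ β (Ad (γ j t)⁻¹ (X i)) (Ad (γ j t)⁻¹ (X i))) 0 *
        deriv (fun t ↦ f ((a * γ j t * a⁻¹) • a • ((1 : G) : G ⧸ L))) 0) := by
  have hd : ∀ i, MDifferentiableAt 𝓘(ℝ, ℝ) (𝓡 d) (γ i) 0 := fun i ↦
    (hγ i).smooth.mdifferentiableAt (by simp)
  have hv : ∀ i, velocity (γ i) = X i := fun i ↦ (hγ i).velocity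
  have hstep : ∀ c : G, (a * c * a⁻¹) • a • ((1 : G) : G ⧸ L) = a • (c : G ⧸ L) := fun c ↦ by
    change (((a * c * a⁻¹) * (a * 1) : G) : G ⧸ L) = ((a * c : G) : G ⧸ L)
    congr 1
    group
  have hvel : ∀ i, velocity (n := e) (fun t ↦ (a * γ i t * a⁻¹) • a • ((1 : G) : G ⧸ L)) =
      (mfderiv (𝓡 e) (𝓡 e) (fun y : G ⧸ L ↦ a • y) ((1 : G) : G ⧸ L) :
        EuclideanSpace ℝ (Fin e) →L[ℝ] EuclideanSpace ℝ (Fin e)) (dproj L (X i)) := fun i ↦ by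
    simp only [hstep]
    rw [velocity_smul_mk hL a (hd i) (hγ i).zero, hv]
  have hspeed : ∀ i j t, speedSq g (fun s ↦ (a * γ i s * a⁻¹) •
      (a * γ j t * a⁻¹) • a • ((1 : G) : G ⧸ L)) =
        β (Ad (γ j t)⁻¹ (X i)) (Ad (γ j t)⁻¹ (X i)) := fun i j t ↦ by
    have h1 : (fun s ↦ (a * γ i s * a⁻¹) • (a * γ j t * a⁻¹) • a • ((1 : G) : G ⧸ L)) =
        fun s ↦ (a * γ j t) • ((((γ j t)⁻¹ * γ i s * ((γ j t)⁻¹)⁻¹ : G)) : G ⧸ L) := by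
      funext s
      rw [hstep]
      change (((a * γ i s * a⁻¹) * (a * γ j t) : G) : G ⧸ L) =
        (((a * γ j t) * ((γ j t)⁻¹ * γ i s * ((γ j t)⁻¹)⁻¹) : G) : G ⧸ L)
      congr 1
      group
    have h2 : MDifferentiableAt 𝓘(ℝ, ℝ) (𝓡 d)
        (fun s ↦ (γ j t)⁻¹ * γ i s * ((γ j t)⁻¹)⁻¹) 0 :=
      MDifferentiableAt.comp (0 : ℝ) (g := fun x : G ↦ (γ j t)⁻¹ * x * ((γ j t)⁻¹)⁻¹)
        ((contMDiff_conj (γ j t)⁻¹).mdifferentiable (by simp) _) (hd i)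
    rw [h1, speedSq_smul_mk hL hg _ h2 (by simp [(hγ i).zero]),
      velocity_conj _ (hd i) (hγ i).zero, hv]
    exact hβ _ _
  rw [laplacian_eq_sum_flows g hf (Θ := fun i t y ↦ (a * γ i t * a⁻¹) • y)]
  -- the remaining goals are the hypotheses on the flows
  · simp only [hspeed]
  · intro i
    have h1 : ContMDiffAt (𝓘(ℝ, ℝ).prod (𝓡 e)) (𝓡 d) ∞
        (fun z : ℝ × G ⧸ L ↦ a * γ i z.1 * a⁻¹) (0, a • ((1 : G) : G ⧸ L)) :=
      ContMDiffAt.comp (x := ((0 : ℝ), a • ((1 : G) : G ⧸ L))) (g := fun t ↦ a * γ i t * a⁻¹)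
        (f := Prod.fst)
        (ContMDiffAt.comp (0 : ℝ) (g := fun x : G ↦ a * x * a⁻¹) (contMDiff_conj a).contMDiffAt
          (hγ i).smooth) contMDiffAt_fst
    exact ContMDiffAt.comp (x := ((0 : ℝ), a • ((1 : G) : G ⧸ L)))
      (g := fun z : G × G ⧸ L ↦ z.1 • z.2) hL.contMDiff_smul.contMDiffAt
      (h1.prodMk contMDiffAt_snd)
  · intro i y
    simp [(hγ i).zero]
  · exact fun i t ↦ hL.mdifferentiable_smul _
  · exact fun i t y u v ↦ hg _ y u v
  · intro u v
    obtain ⟨U, rfl⟩ := exists_mfderiv_smul_dproj_eq hL hg a u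
    obtain ⟨V, rfl⟩ := exists_mfderiv_smul_dproj_eq hL hg a v
    have h : ∀ U V : GroupLieAlgebra (𝓡 d) G, g.inner (a • ((1 : G) : G ⧸ L))
        ((mfderiv (𝓡 e) (𝓡 e) (fun y : G ⧸ L ↦ a • y) ((1 : G) : G ⧸ L) :
          EuclideanSpace ℝ (Fin e) →L[ℝ] EuclideanSpace ℝ (Fin e)) (dproj L U))
        ((mfderiv (𝓡 e) (𝓡 e) (fun y : G ⧸ L ↦ a • y) ((1 : G) : G ⧸ L) :
          EuclideanSpace ℝ (Fin e) →L[ℝ] EuclideanSpace ℝ (Fin e)) (dproj L V)) = β U V :=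
      fun U V ↦ (hg a _ _ _).trans (hβ U V)
    simp only [hvel]
    refine (h U V).trans ((hpars U V).trans (Finset.sum_congr rfl fun i _ ↦ ?_))
    exact (congrArg₂ (· * ·) (h U (X i)) (h V (X i))).symm

end Homogeneous

/-! ### The Laplacian and pullback along the fibration -/

section Fibration

variable {d dK dH : ℕ} {G : Type*} [TopologicalSpace G]
  [ChartedSpace (EuclideanSpace ℝ (Fin d)) G] [Group G] {K H : Subgroup G}
  [ChartedSpace (EuclideanSpace ℝ (Fin dK)) (G ⧸ K)]
  [ChartedSpace (EuclideanSpace ℝ (Fin dH)) (G ⧸ H)] [IsManifold (𝓡 dH) ∞ (G ⧸ H)]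

/-- The projection `G ⧸ K → G ⧸ H` is smooth. -/
theorem IsQuotientManifold.contMDiff_quotientMapOfLE (hle : K ≤ H)
    (hK : IsQuotientManifold (d := d) (e := dK) K) (hH : IsQuotientManifold (d := d) (e := dH) H) :
    ContMDiff (𝓡 dK) (𝓡 dH) ∞ (Subgroup.quotientMapOfLE hle) := by
  intro y
  induction y using QuotientGroup.induction_on with | _ a =>
  exact hK.contMDiffAt_of_comp_mk le_rfl (f := Subgroup.quotientMapOfLE hle)
    hH.contMDiff_mk.contMDiffAt

variable [LieGroup (𝓡 d) ∞ G] [IsManifold (𝓡 dK) ∞ (G ⧸ K)]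
  {m p : Submodule ℝ (GroupLieAlgebra (𝓡 d) G)}
  {Bm : m →ₗ[ℝ] m →ₗ[ℝ] ℝ} {Bp : p →ₗ[ℝ] p →ₗ[ℝ] ℝ}
  {g' : RiemMetric dK (G ⧸ K)} {g : RiemMetric dH (G ⧸ H)}

/-- The projections onto `m` and `p` of the decomposition `𝔤 = 𝔨 ⊕ p ⊕ m`. -/
theorem IsHomogeneousRiemannianFibration.exists_projections
    (hπ : IsHomogeneousRiemannianFibration K H m p Bm Bp g' g) :
    ∃ (P : GroupLieAlgebra (𝓡 d) G →ₗ[ℝ] m) (Q : GroupLieAlgebra (𝓡 d) G →ₗ[ℝ] p),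
      (∀ U, U - (Q U + P U) ∈ lieAlgebraOf K) ∧ (∀ U, U - P U ∈ lieAlgebraOf H) ∧
      (∀ X : m, P X = X) ∧ (∀ X : m, Q X = 0) ∧ (∀ Y : p, P Y = 0) ∧ (∀ Y : p, Q Y = Y) := by
  have hp : p ≤ lieAlgebraOf H := hπ.sup_p ▸ le_sup_right
  have hk : lieAlgebraOf K ≤ lieAlgebraOf H := hπ.sup_p ▸ le_sup_left
  have hc : IsCompl p (lieAlgebraOf K ⊔ m) := by
    constructor
    · rw [Submodule.disjoint_def]
      intro x hx hx'
      obtain ⟨k, hk', y, hy, rfl⟩ := Submodule.mem_sup.1 hx'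
      have hy0 : y = 0 := Submodule.disjoint_def.1 hπ.isCompl_m.disjoint y
        (by simpa using Submodule.sub_mem _ (hp hx) (hk hk')) hy
      subst hy0
      rw [add_zero] at hx ⊢
      have : k ∈ lieAlgebraOf K ⊓ p := ⟨hk', hx⟩
      rwa [hπ.inf_p] at this
    · rw [codisjoint_iff, ← sup_assoc, sup_comm p, hπ.sup_p]
      exact hπ.isCompl_m.sup_eq_top
  have hm := hπ.isCompl_m.symm
  let P := m.projectionOnto (lieAlgebraOf H) hm
  let Q := p.projectionOnto (lieAlgebraOf K ⊔ m) hc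
  have hPm : ∀ X : m, P X = X := fun X ↦ Submodule.projectionOnto_apply_left hm X
  have hPh : ∀ X ∈ lieAlgebraOf H, P X = 0 := fun X hX ↦ by
    rw [← LinearMap.mem_ker, Submodule.ker_projectionOnto]; exact hX
  have hQp : ∀ Y : p, Q Y = Y := fun Y ↦ Submodule.projectionOnto_apply_left hc Y
  have hQ0 : ∀ X ∈ lieAlgebraOf K ⊔ m, Q X = 0 := fun X hX ↦ by
    rw [← LinearMap.mem_ker, Submodule.ker_projectionOnto]; exact hX
  have hdec : ∀ U, ∃ k ∈ lieAlgebraOf (d := d) K, ∃ (Y : p) (X : m), U = k + Y + X := fun U ↦ by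
    have hU : U ∈ lieAlgebraOf K ⊔ p ⊔ m := by
      rw [hπ.sup_p, hπ.isCompl_m.sup_eq_top]; exact Submodule.mem_top
    obtain ⟨h, hh, X, hX, rfl⟩ := Submodule.mem_sup.1 hU
    obtain ⟨k, hk', Y, hY, rfl⟩ := Submodule.mem_sup.1 hh
    exact ⟨k, hk', ⟨Y, hY⟩, ⟨X, hX⟩, rfl⟩
  have hval : ∀ k ∈ lieAlgebraOf (d := d) K, ∀ (Y : p) (X : m),
      P (k + Y + X) = X ∧ Q (k + Y + X) = Y := fun k hk' Y X ↦ by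
    constructor
    · rw [map_add, map_add, hPm, hPh k (hk hk'), hPh Y (hp Y.2), add_zero, zero_add]
    · rw [map_add, map_add, hQp, hQ0 k (Submodule.mem_sup_left hk'),
        hQ0 X (Submodule.mem_sup_right X.2), add_zero, zero_add]
  refine ⟨P, Q, fun U ↦ ?_, fun U ↦ ?_, hPm,
    fun X ↦ hQ0 _ (Submodule.mem_sup_right X.2), fun Y ↦ hPh _ (hp Y.2), hQp⟩
  · obtain ⟨k, hk', Y, X, rfl⟩ := hdec U
    rw [(hval k hk' Y X).1, (hval k hk' Y X).2]
    have : k + (Y : GroupLieAlgebra (𝓡 d) G) + X - (Y + X) = k := by abel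
    rwa [this]
  · obtain ⟨k, hk', Y, X, rfl⟩ := hdec U
    rw [(hval k hk' Y X).1, add_sub_cancel_right]
    exact Submodule.add_mem _ (hk hk') (hp Y.2)

theorem dproj_eq_of_sub_mem (hK : IsQuotientManifold (d := d) (e := dK) K)
    {U V : GroupLieAlgebra (𝓡 d) G} (h : U - V ∈ lieAlgebraOf K) :
    dproj (e := dK) K U = dproj K V := by
  have h1 := dproj_add (e := dK) (L := K) (U - V) V
  rw [sub_add_cancel, dproj_eq_zero hK h, zero_add] at h1
  exact h1

/-- For a homogeneous Riemannian fibration `π`, the Laplacian commutes with pullback by `π`. Both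
sides are computed from the same curves, with velocities in orthonormal bases of `m` and `p`: on the
base the velocities in `p` contribute nothing, and upstairs the extra terms vanish since
`[m, 𝔥] ⊆ m` makes the fibres totally geodesic. -/
theorem IsHomogeneousRiemannianFibration.laplacian_comp
    (hπ : IsHomogeneousRiemannianFibration K H m p Bm Bp g' g) (a : G) {f : G ⧸ H → ℝ}
    (hf : ContMDiffAt (𝓡 dH) 𝓘(ℝ, ℝ) 2 f (a : G ⧸ H))
    (hf' : ContMDiffAt (𝓡 dK) 𝓘(ℝ, ℝ) 2 (f ∘ Subgroup.quotientMapOfLE hπ.le) (a : G ⧸ K)) :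
    laplacian g' (f ∘ Subgroup.quotientMapOfLE hπ.le) (a : G ⧸ K) = laplacian g f (a : G ⧸ H) := by
  obtain ⟨P, Q, hPQ, hP, hPm, hQm, hPp, hQp⟩ := hπ.exists_projections
  have hp : p ≤ lieAlgebraOf H := hπ.sup_p ▸ le_sup_right
  have : FiniteDimensional ℝ (GroupLieAlgebra (𝓡 d) G) :=
    inferInstanceAs (FiniteDimensional ℝ (EuclideanSpace ℝ (Fin d)))
  obtain ⟨r, vm, hvm⟩ := exists_parseval_family Bm hπ.scalarProduct_m.symm hπ.scalarProduct_m.pos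
  obtain ⟨s, vp, hvp⟩ := exists_parseval_family Bp hπ.scalarProduct_p.symm hπ.scalarProduct_p.pos
  let X : Fin r ⊕ Fin s → GroupLieAlgebra (𝓡 d) G :=
    Sum.elim (fun i ↦ (vm i : GroupLieAlgebra (𝓡 d) G)) fun j ↦ (vp j : GroupLieAlgebra (𝓡 d) G)
  let S : Fin r ⊕ Fin s → Subgroup G := Sum.elim (fun _ ↦ ⊤) fun _ ↦ H
  have hcurve : ∀ i, ∃ γ : ℝ → G, IsCurveIn (S i) (X i) γ := by
    rintro (i | j)
    · exact exists_isCurveIn_top _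
    · exact hp (vp j).2
  choose γ hγ using hcurve
  have ha : ∀ L : Subgroup G, a • ((1 : G) : G ⧸ L) = (a : G ⧸ L) := fun L ↦ by
    change ((a * 1 : G) : G ⧸ L) = _
    rw [mul_one]
  -- the scalar products on the Lie algebra pulled back from the tangent spaces at the base points
  have hβH : ∀ U V, g.inner ((1 : G) : G ⧸ H) (dproj (d := d) H U) (dproj (d := d) H V) =
      Bm (P U) (P V) := fun U V ↦ by
    rw [dproj_eq_of_sub_mem hπ.isQuotient_H (hP U), dproj_eq_of_sub_mem hπ.isQuotient_H (hP V)]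
    exact hπ.induced_base _ _
  have hβK : ∀ U V, g'.inner ((1 : G) : G ⧸ K) (dproj (d := d) K U) (dproj (d := d) K V) =
      Bm (P U) (P V) + Bp (Q U) (Q V) := fun U V ↦ by
    rw [dproj_eq_of_sub_mem hπ.isQuotient_K (hPQ U), dproj_eq_of_sub_mem hπ.isQuotient_K (hPQ V),
      add_comm (Q U : GroupLieAlgebra (𝓡 d) G), add_comm (Q V : GroupLieAlgebra (𝓡 d) G)]
    exact hπ.induced_total _ _ _ _
  have hparsH : ∀ U V, Bm (P U) (P V) = ∑ i, Bm (P U) (P (X i)) * Bm (P V) (P (X i)) :=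
    fun U V ↦ by
      rw [Fintype.sum_sum_type]
      simp [X, hPm, hPp, ← hvm]
  have hparsK : ∀ U V, Bm (P U) (P V) + Bp (Q U) (Q V) =
      ∑ i, (Bm (P U) (P (X i)) + Bp (Q U) (Q (X i))) *
        (Bm (P V) (P (X i)) + Bp (Q V) (Q (X i))) := fun U V ↦ by
    rw [Fintype.sum_sum_type]
    simp [X, hPm, hPp, hQm, hQp, ← hvm, ← hvp]
  have hH := laplacian_eq_sum_Ad hπ.isQuotient_H hπ.invariant_base hγ hβH hparsH a
    (f := f) (by rw [ha]; exact hf)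
  have hK := laplacian_eq_sum_Ad hπ.isQuotient_K hπ.invariant_total hγ hβK hparsK a
    (f := f ∘ Subgroup.quotientMapOfLE hπ.le) (by rw [ha]; exact hf')
  rw [ha] at hH hK
  have hcomp : ∀ b c : G, (f ∘ Subgroup.quotientMapOfLE hπ.le) (b • c • (a : G ⧸ K)) =
      f (b • c • (a : G ⧸ H)) := fun _ _ ↦ rfl
  have hcomp' : ∀ b : G, (f ∘ Subgroup.quotientMapOfLE hπ.le) (b • (a : G ⧸ K)) =
      f (b • (a : G ⧸ H)) := fun _ ↦ rfl
  simp only [hcomp, hcomp'] at hK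
  rw [hH, hK]
  refine Finset.sum_congr rfl fun i _ ↦ congrArg _ (Finset.sum_congr rfl fun j _ ↦ ?_)
  rcases j with j | j
  · -- along `m`, the vertical part of the metric contributes nothing
    obtain ⟨W, hW, hW'⟩ := exists_hasDerivAt_Ad (hγ (Sum.inl j)) (hγ i)
    let bm : EuclideanSpace ℝ (Fin d) →ₗ[ℝ] EuclideanSpace ℝ (Fin d) →ₗ[ℝ] ℝ := Bm.compl₁₂ P P
    let bp : EuclideanSpace ℝ (Fin d) →ₗ[ℝ] EuclideanSpace ℝ (Fin d) →ₗ[ℝ] ℝ := Bp.compl₁₂ Q Q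
    have h1 := hasDerivAt_bilin_self bm hW
    have h2 := hasDerivAt_bilin_self bp hW
    have h0 : Ad (d := d) (γ (Sum.inl j) 0)⁻¹ (X i) = X i := by
      refine mfderiv_apply_of_eq_id ?_ 1 _
      funext x
      simp [(hγ (Sum.inl j)).zero]
    have hz : bp W (X i) + bp (X i) W = 0 := by
      have hsymm : bp W (X i) = bp (X i) W := hπ.scalarProduct_p.symm _ _
      rw [hsymm]
      suffices h : bp (X i) W = 0 by rw [h, add_zero]
      rcases i with i | i
      · have h : Q (X (Sum.inl i)) = 0 := hQm (vm i)
        change Bp (Q (X (Sum.inl i))) (Q W) = 0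
        rw [h, map_zero, LinearMap.zero_apply]
      · -- `W` is the derivative of a curve in `m`, on which the vertical part vanishes
        have h4 := (bp (X (Sum.inr i))).toContinuousLinearMap.hasFDerivAt.comp_hasDerivAt
          (0 : ℝ) hW'
        refine (h4.unique ((hasDerivAt_const (0 : ℝ) (0 : ℝ)).congr_of_eventuallyEq
          (Filter.Eventually.of_forall fun t ↦ ?_)))
        have hmem : Ad (γ (Sum.inr i) t) (X (Sum.inl j)) ∈ m :=
          hπ.scalarProduct_m.isAdInvariant _ ((hγ (Sum.inr i)).mem t) _ (vm j).2
        change Bp (Q (X (Sum.inr i))) (Q (Ad (γ (Sum.inr i) t) (X (Sum.inl j)))) = 0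
        rw [show Q (Ad (γ (Sum.inr i) t) (X (Sum.inl j))) = 0 from hQm ⟨_, hmem⟩, map_zero]
    have h3 : deriv (fun t ↦ Bm (P (Ad (γ (Sum.inl j) t)⁻¹ (X i)))
        (P (Ad (γ (Sum.inl j) t)⁻¹ (X i))) + Bp (Q (Ad (γ (Sum.inl j) t)⁻¹ (X i)))
        (Q (Ad (γ (Sum.inl j) t)⁻¹ (X i)))) 0 = deriv (fun t ↦ Bm (P (Ad (γ (Sum.inl j) t)⁻¹ (X i)))
        (P (Ad (γ (Sum.inl j) t)⁻¹ (X i)))) 0 := by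
      have h2' := h2
      rw [h0, hz] at h2'
      refine (h1.add h2').deriv.trans ?_
      rw [add_zero]
      exact h1.deriv.symm
    rw [h3]
  · -- along `p`, the function is constant
    have hconst : ∀ t, f ((a * γ (Sum.inr j) t * a⁻¹) • (a : G ⧸ H)) = f (a : G ⧸ H) := fun t ↦ by
      congr 1
      change ((a * γ (Sum.inr j) t * a⁻¹ * a : G) : G ⧸ H) = _
      rw [QuotientGroup.eq]
      have hmem : γ (Sum.inr j) t ∈ H := (hγ (Sum.inr j)).mem t
      simpa using hmem
    simp only [hconst, deriv_const, mul_zero]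

end Fibration

end HarmonicMorphism

end

open HarmonicMorphism in
theorem proposition3p2 {d dK dH n : ℕ} {G : Type*} [TopologicalSpace G]
    [ChartedSpace (EuclideanSpace ℝ (Fin d)) G] [Group G] [LieGroup (𝓡 d) ∞ G]
    (K H : Subgroup G)
    [ChartedSpace (EuclideanSpace ℝ (Fin dK)) (G ⧸ K)] [IsManifold (𝓡 dK) ∞ (G ⧸ K)]
    [ChartedSpace (EuclideanSpace ℝ (Fin dH)) (G ⧸ H)] [IsManifold (𝓡 dH) ∞ (G ⧸ H)]
    (m p : Submodule ℝ (GroupLieAlgebra (𝓡 d) G))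
    (Bm : m →ₗ[ℝ] m →ₗ[ℝ] ℝ) (Bp : p →ₗ[ℝ] p →ₗ[ℝ] ℝ)
    (g' : RiemMetric dK (G ⧸ K)) (g : RiemMetric dH (G ⧸ H))
    (hπ : IsHomogeneousRiemannianFibration K H m p Bm Bp g' g)
    {N : Type*} [TopologicalSpace N] [ChartedSpace (EuclideanSpace ℝ (Fin n)) N]
    [IsManifold (𝓡 n) ∞ N] (h : RiemMetric n N) (φ : G ⧸ H → N) :
    IsHarmonicMorphism g h φ ↔
      IsHarmonicMorphism g' h (φ ∘ Subgroup.quotientMapOfLE hπ.le) := by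
  have hsmooth := hπ.isQuotient_K.contMDiff_quotientMapOfLE hπ.le hπ.isQuotient_H
  have hlift : ∀ {f : G ⧸ H → ℝ} {U : Set (G ⧸ H)}, IsOpen U → ContMDiffOn (𝓡 dH) 𝓘(ℝ, ℝ) 2 f U →
      ∀ y, Subgroup.quotientMapOfLE hπ.le y ∈ U →
        ContMDiffAt (𝓡 dK) 𝓘(ℝ, ℝ) 2 (f ∘ Subgroup.quotientMapOfLE hπ.le) y :=
    fun hU hf y hy ↦ ContMDiffAt.comp y (hf.contMDiffAt (hU.mem_nhds hy))
      (hsmooth.contMDiffAt.of_le ENat.LEInfty.out)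
  constructor
  · intro hφ
    refine ⟨hφ.continuous.comp hsmooth.continuous, fun U f hf hne ↦ ?_⟩
    obtain ⟨y, hy⟩ := hne
    have hf' := hφ.comp U f hf ⟨_, hy⟩
    refine ⟨hf'.isOpen.preimage hsmooth.continuous,
      fun z hz ↦ (hlift hf'.isOpen hf'.contMDiffOn z hz).contMDiffWithinAt, fun z hz ↦ ?_⟩
    induction z using QuotientGroup.induction_on with | _ a =>
    exact (hπ.laplacian_comp a (f := f ∘ φ)
      (hf'.contMDiffOn.contMDiffAt (hf'.isOpen.mem_nhds hz))
      (hlift hf'.isOpen hf'.contMDiffOn _ hz)).trans (hf'.laplacian_eq_zero _ hz)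
  · intro hψ
    have hφ : Continuous φ := by
      have := topologicalGroup_of_lieGroup (𝓡 d) (G := G) ∞
      refine (QuotientGroup.isOpenQuotientMap_mk (N := H)).isQuotientMap.continuous_iff.2 ?_
      exact hψ.continuous.comp hπ.isQuotient_K.contMDiff_mk.continuous
    refine ⟨hφ, fun U f hf hne ↦ ?_⟩
    have hf' := hψ.comp U f hf (by
      obtain ⟨y, hy⟩ := hne
      induction y using QuotientGroup.induction_on with | _ a =>
      exact ⟨(a : G ⧸ K), hy⟩)
    have hup : ∀ a : G, (a : G ⧸ H) ∈ φ ⁻¹' U → ContMDiffAt (𝓡 dK) 𝓘(ℝ, ℝ) 2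
        ((f ∘ φ) ∘ Subgroup.quotientMapOfLE hπ.le) (a : G ⧸ K) := fun a ha ↦
      hf'.contMDiffOn.contMDiffAt (hf'.isOpen.mem_nhds ha)
    have hdown : ∀ a : G, (a : G ⧸ H) ∈ φ ⁻¹' U →
        ContMDiffAt (𝓡 dH) 𝓘(ℝ, ℝ) 2 (f ∘ φ) (a : G ⧸ H) := fun a ha ↦
      hπ.isQuotient_H.contMDiffAt_of_comp_mk ENat.LEInfty.out (f := f ∘ φ)
        (ContMDiffAt.comp a (f := fun b : G ↦ (b : G ⧸ K)) (hup a ha)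
          (hπ.isQuotient_K.contMDiff_mk.contMDiffAt.of_le ENat.LEInfty.out))
    refine ⟨hf.isOpen.preimage hφ, fun z hz ↦ ?_, fun z hz ↦ ?_⟩
    · induction z using QuotientGroup.induction_on with | _ a =>
      exact (hdown a hz).contMDiffWithinAt
    · induction z using QuotientGroup.induction_on with | _ a =>
      exact (hπ.laplacian_comp a (f := f ∘ φ) (hdown a hz) (hup a hz)).symm.trans
        (hf'.laplacian_eq_zero (a : G ⧸ K) hz)
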